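/- **Conventions.** Let $M=\mathrm{Mon}\langle\sigma\mid\rho\rangle$ be a homogeneously presented (HP) monoid: every relation $(u,v)\in\rho$ is a pair of words in $\sigma$ of the same length. Assume $M$ is *Ore*: it is left-cancellative and any two elements have a common right-multiple. Let $\mathrm{Frac}(M)$ be its group of fractions $[x,y]$ (with $[x,y]=[xz,yz]$ and $[x,y][y,z]=[x,z]$), let $\mathrm{Frac}(M)\to\mathbf Z$, $[x,y]\mapsto |x|-|y|$ be the length map, and let $K_M$ be its kernel. Fix a generator $a\in\sigma$, also viewed as the element $[a,1]$ of $\mathrm{Frac}(M)$. Let $\mathcal F_M$ be the forest-skein category of $M$: its objects are the natural numbers, its morphisms $n\to m$ are the binary forests with $n$ roots and $m$ leaves whose interior vertices are coloured by $\sigma$, modulo the relations which, for every $(u,v)\in\rho$, replace a left-vine coloured (from the root to the first leaf) by $u$ with the left-vine coloured by $v$, anywhere inside a forest; composition is vertical stacking. For $X=F,T,V,BV$ let $\mathcal F_M^X$ be the category of forests of $\mathcal F_M$ with on top of their leaves nothing, a cyclic permutation, a permutation, or a braid, respectively. When a category is Ore (left-cancellative, and any two morphisms with the same source have a common right-multiple),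 its fraction group at an object $x$ is the group of classes $[f,g]$ of pairs of morphisms with source $x$ and with the same target, where $[f,g]=[f\circ p,g\circ p]$ and $[f,g][g,h]=[f,h]$. The forest-skein group $G^X$ is the fraction group of $\mathcal F_M^X$ at the object $1$. The (braided) Thompson group $X$ itself is the group obtained in this way from one colour and no relation. Let $\mathbf Q_2=\mathbf Z[1/2]\cap[0,1)$. The groups $F$, $T$, $V$ act on $\mathbf Q_2$ in the usual way by piecewise affine maps ($[f,g]$ sends the standard dyadic interval of each leaf of $g$ affinely onto that of the corresponding leaf of $f$), and $BV$ acts through the canonical map $BV\to V$. For $v\in X$ and $q\in\mathbf Q_2$ let $v'(q)$ be the right-derivative at $q$ of (the image in $V$ of) $v$, which is a power of $2$. Let $\bigoplus_{\mathbf Q_2}K_M$ be the group of finitely supported maps $\mathbf Q_2\to K_M$. **Theorem A.** For every $X\in\{F,T,V,BV\}$ the category $\mathcal F_M^X$ is an Ore category, and there is a group isomorphism $$G^X\;\simeq\;\Big(\bigoplus_{\mathbf Q_2}K_M\Big)\rtimes X$$ onto the twisted permutational restricted wreath product in which $X$ acts on $\bigoplus_{\mathbf Q_2}K_M$ by $$(v\cdot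 k)(q)=a^{-\log_2 v'(v^{-1}q)}\; k(v^{-1}q)\; a^{\log_2 v'(v^{-1}q)},\qquad v\in X,\ k\in\bigoplus_{\mathbf Q_2}K_M,\ q\in\mathbf Q_2 .$$ In particular, if $a$ is central in $\mathrm{Frac}(M)$, then the twist is trivial: for all $v\in X$, $q\in\mathbf Q_2$, the automorphism $k\mapsto a^{-\log_2 v'(v^{-1}q)}\,k\,a^{\log_2 v'(v^{-1}q)}$ of $K_M$ is the identity. -/

import Mathlib

open CategoryTheory

universe u v

namespace ForestSkein

/-! ### Calculus of fractions -/

/-- A category is an Ore category (admits a right-calculus of fractions) when it is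
left-cancellative and any two morphisms with the same source have a common right-multiple.
Diagrams are composed from bottom to top: `f ≫ g` is the composition `f ∘ g` in which `g` is stacked
on top of `f`. -/
class IsOreCategory (C : Type u) [Category.{v} C] : Prop where
  left_cancel : ∀ {x y z : C} (f : x ⟶ y) (g g' : y ⟶ z), f ≫ g = f ≫ g' → g = g'
  common_multiple : ∀ {x y z : C} (f : x ⟶ y) (g : x ⟶ z),
    ∃ (w : C) (p : y ⟶ w) (q : z ⟶ w), f ≫ p = g ≫ q

section Fractions

variable {C : Type u} [Category.{v} C]

/-- A pair of morphisms with common source `x` and common target. -/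
structure FracPair (x : C) where
  tgt : C
  num : x ⟶ tgt
  den : x ⟶ tgt

/-- The elementary move `(f, g) ↦ (f ∘ p, g ∘ p)`. -/
def FracStep (x : C) (P Q : FracPair x) : Prop :=
  ∃ (z : C) (p : P.tgt ⟶ z), Q = ⟨z, P.num ≫ p, P.den ≫ p⟩

/-- The fraction group at the object `x`: classes `[f, g]` of pairs of morphisms starting at `x`
with the same target, for the equivalence relation generated by `(f, g) ∼ (f ∘ p, g ∘ p)`.
It is the isotropy group at `x` of the fraction groupoid of `C`; the group structure is given below
when `C` is an Ore category. -/
def FracGroup (C : Type u) [Category.{v} C] (x : C) : Type (max u v) := Quot (FracStep x)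

/-- The class `[f, g]`. -/
def frac {x y : C} (f g : x ⟶ y) : FracGroup C x := Quot.mk _ ⟨y, f, g⟩

theorem frac_comp {x y z : C} (f g : x ⟶ y) (p : y ⟶ z) : frac (f ≫ p) (g ≫ p) = frac f g :=
  (Quot.sound ⟨z, p, rfl⟩).symm

theorem FracGroup.exists_rep {x : C} (a : FracGroup C x) :
    ∃ (y : C) (f g : x ⟶ y), a = frac f g := by
  induction a using Quot.ind with
  | mk P => exact ⟨P.tgt, P.num, P.den, rfl⟩

/-- The inverse `[f, g]⁻¹ = [g, f]`. -/
def fracInv {x : C} : FracGroup C x → FracGroup C x :=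
  Quot.lift (fun P => frac P.den P.num) (by
    rintro P _ ⟨z, r, rfl⟩
    exact (frac_comp _ _ r).symm)

instance (x : C) : Inv (FracGroup C x) := ⟨fracInv⟩
instance (x : C) : One (FracGroup C x) := ⟨frac (𝟙 x) (𝟙 x)⟩

theorem frac_inv {x y : C} (f g : x ⟶ y) : (frac f g)⁻¹ = frac g f := rfl

theorem frac_self {x y : C} (f : x ⟶ y) : frac f f = (1 : FracGroup C x) := by
  have := frac_comp (𝟙 x) (𝟙 x) f
  rwa [Category.id_comp] at this

variable [IsOreCategory C]

theorem frac_mul_wd {x y y' w w' : C} (f g : x ⟶ y) (f' g' : x ⟶ y')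
    (p : y ⟶ w) (q : y' ⟶ w) (p' : y ⟶ w') (q' : y' ⟶ w')
    (h : g ≫ p = f' ≫ q) (h' : g ≫ p' = f' ≫ q') :
    frac (f ≫ p) (g' ≫ q) = frac (f ≫ p') (g' ≫ q') := by
  obtain ⟨z, s, t, hst⟩ := IsOreCategory.common_multiple p p'
  have key : q ≫ s = q' ≫ t := by
    apply IsOreCategory.left_cancel f'
    rw [← Category.assoc, ← h, ← Category.assoc, ← h', Category.assoc, Category.assoc, hst]
  rw [← frac_comp (f ≫ p) (g' ≫ q) s, ← frac_comp (f ≫ p') (g' ≫ q') t]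
  simp only [Category.assoc, hst, key]

/-- The product `[f, g] · [f', g'] = [f ∘ p, g' ∘ q]` where `g ∘ p = f' ∘ q`, on pairs. -/
noncomputable def fracMulPair {x : C} (P Q : FracPair x) : FracGroup C x :=
  frac (P.num ≫ (IsOreCategory.common_multiple P.den Q.num).choose_spec.choose)
    (Q.den ≫ (IsOreCategory.common_multiple P.den Q.num).choose_spec.choose_spec.choose)

theorem fracMulPair_eq {x : C} (P Q : FracPair x) {w : C} (p : P.tgt ⟶ w) (q : Q.tgt ⟶ w)
    (h : P.den ≫ p = Q.num ≫ q) : fracMulPair P Q = frac (P.num ≫ p) (Q.den ≫ q) :=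
  frac_mul_wd _ _ _ _ _ _ _ _
    (IsOreCategory.common_multiple P.den Q.num).choose_spec.choose_spec.choose_spec h

/-- The product on the fraction group. -/
noncomputable def fracMul {x : C} : FracGroup C x → FracGroup C x → FracGroup C x :=
  Quot.lift (fun P => Quot.lift (fun Q => fracMulPair P Q) (by
      rintro Q _ ⟨z, r, rfl⟩
      obtain ⟨w, p, q, h⟩ := IsOreCategory.common_multiple P.den (Q.num ≫ r)
      rw [fracMulPair_eq P Q p (r ≫ q) (by simpa using h),
        fracMulPair_eq P ⟨z, Q.num ≫ r, Q.den ≫ r⟩ p q h, Category.assoc])) (by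
      rintro P _ ⟨z, r, rfl⟩
      funext Q
      induction Q using Quot.ind with
      | mk Q =>
        obtain ⟨w, p, q, h⟩ := IsOreCategory.common_multiple (P.den ≫ r) Q.num
        change fracMulPair P Q = fracMulPair _ Q
        rw [fracMulPair_eq P Q (r ≫ p) q (by simpa using h),
          fracMulPair_eq ⟨z, P.num ≫ r, P.den ≫ r⟩ Q p q h, Category.assoc])

noncomputable instance (x : C) : Mul (FracGroup C x) := ⟨fracMul⟩

theorem frac_mul {x y y' w : C} (f g : x ⟶ y) (f' g' : x ⟶ y') (p : y ⟶ w) (q : y' ⟶ w)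
    (h : g ≫ p = f' ≫ q) : frac f g * frac f' g' = frac (f ≫ p) (g' ≫ q) :=
  fracMulPair_eq ⟨y, f, g⟩ ⟨y', f', g'⟩ p q h

theorem frac_mul_same {x y : C} (f g h : x ⟶ y) : frac f g * frac g h = frac f h := by
  rw [frac_mul f g g h (𝟙 y) (𝟙 y) rfl, Category.comp_id, Category.comp_id]

/-- Two fractions can be written with a common middle term. -/
theorem exists_rep₂ {x : C} (a b : FracGroup C x) :
    ∃ (y : C) (f g h : x ⟶ y), a = frac f g ∧ b = frac g h := by
  obtain ⟨y, f, g, rfl⟩ := a.exists_rep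
  obtain ⟨y', f', g', rfl⟩ := b.exists_rep
  obtain ⟨w, p, q, h⟩ := IsOreCategory.common_multiple g f'
  refine ⟨w, f ≫ p, g ≫ p, g' ≫ q, (frac_comp _ _ _).symm, ?_⟩
  rw [h, frac_comp]

noncomputable instance (x : C) : Group (FracGroup C x) where
  mul_assoc a b c := by
    obtain ⟨y, f₁, g₁, rfl⟩ := a.exists_rep
    obtain ⟨y₂, f₂, g₂, rfl⟩ := b.exists_rep
    obtain ⟨y₃, f₃, g₃, rfl⟩ := c.exists_rep
    obtain ⟨w, u, v, h⟩ := IsOreCategory.common_multiple g₁ f₂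
    obtain ⟨w', r, s, h'⟩ := IsOreCategory.common_multiple g₂ f₃
    obtain ⟨z, p, q, hz⟩ := IsOreCategory.common_multiple v r
    rw [frac_mul f₁ g₁ f₂ g₂ u v h, frac_mul f₂ g₂ f₃ g₃ r s h',
      frac_mul (f₁ ≫ u) (g₂ ≫ v) f₃ g₃ p (s ≫ q)
        (by rw [Category.assoc, hz, ← Category.assoc, h', Category.assoc]),
      frac_mul f₁ g₁ (f₂ ≫ r) (g₃ ≫ s) (u ≫ p) q
        (by rw [← Category.assoc, h, Category.assoc, hz, Category.assoc])]
    simp only [Category.assoc]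
  one_mul a := by
    obtain ⟨y, f, g, rfl⟩ := a.exists_rep
    rw [← frac_self f, frac_mul_same]
  mul_one a := by
    obtain ⟨y, f, g, rfl⟩ := a.exists_rep
    rw [← frac_self g, frac_mul_same]
  inv_mul_cancel a := by
    obtain ⟨y, f, g, rfl⟩ := a.exists_rep
    rw [frac_inv, frac_mul_same, frac_self]

/-- A functor between Ore categories induces a morphism of fraction groups. -/
def fracMap {D : Type*} [Category* D] [IsOreCategory D] (Φ : C ⥤ D) (x : C) :
    FracGroup C x →* FracGroup D (Φ.obj x) where
  toFun := Quot.lift (fun P => frac (Φ.map P.num) (Φ.map P.den)) (by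
    rintro P _ ⟨z, r, rfl⟩
    simp only [Functor.map_comp]
    exact (frac_comp _ _ _).symm)
  map_one' := by
    change frac (Φ.map (𝟙 x)) (Φ.map (𝟙 x)) = 1
    rw [frac_self]
  map_mul' a b := by
    obtain ⟨y, f, g, h, rfl, rfl⟩ := exists_rep₂ a b
    rw [frac_mul_same]
    change frac (Φ.map f) (Φ.map h) = frac (Φ.map f) (Φ.map g) * frac (Φ.map g) (Φ.map h)
    rw [frac_mul_same]

end Fractions

/-! ### Monoids -/

/-- An Ore monoid: left-cancellative, and any two elements have a common right-multiple. -/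
class IsOreMonoid (M : Type u) [Monoid M] : Prop where
  left_cancel : ∀ x y y' : M, x * y = x * y' → y = y'
  common_multiple : ∀ x y : M, ∃ p q : M, x * p = y * q

/-- The category with one object whose endomorphisms are the elements of `M`, with composition
`x ≫ y = x * y`. -/
structure MonoidCat (M : Type u) : Type where
  star ::

instance (M : Type u) [Monoid M] : Category.{u} (MonoidCat M) where
  Hom _ _ := M
  id _ := 1
  comp x y := x * y
  id_comp := one_mul
  comp_id := mul_one
  assoc := mul_assoc

instance (M : Type u) [Monoid M] [IsOreMonoid M] : IsOreCategory (MonoidCat M) where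
  left_cancel := IsOreMonoid.left_cancel (M := M)
  common_multiple {_ _ z} f g :=
    ⟨z, IsOreMonoid.common_multiple (M := M) f g⟩

/-- The fraction group `Frac(M)` of a monoid: classes `[x, y]` of pairs of elements, with
`[x, y] = [xz, yz]` and `[x, y][x', y'] = [xz, y'z']` for `yz = x'z'`. -/
abbrev Frac (M : Type u) [Monoid M] : Type u := FracGroup (MonoidCat M) (MonoidCat.star (M := M))

/-- The fraction `[x, y]`. -/
def Frac.mk {M : Type u} [Monoid M] (x y : M) : Frac M :=
  frac (C := MonoidCat M) (x := .star) (y := .star) x y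

/-- A homogeneous monoid presentation with generating set `σ`: a set of relations between words
of the same length. -/
structure HPPresentation (σ : Type u) where
  rel : FreeMonoid σ → FreeMonoid σ → Prop
  homogeneous : ∀ u v, rel u v → u.length = v.length

/-- The monoid `Mon⟨σ | ρ⟩`. -/
abbrev HPPresentation.Mon {σ : Type u} (π : HPPresentation σ) : Type u := PresentedMonoid π.rel

/-- The length morphism `Mon⟨σ | ρ⟩ → ℕ`, written multiplicatively with values in `ℤ`. -/
def HPPresentation.lengthHom {σ : Type u} (π : HPPresentation σ) : π.Mon →* Multiplicative ℤ :=
  PresentedMonoid.lift (fun _ => Multiplicative.ofAdd 1) (by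
    intro u v h
    have : ∀ w : FreeMonoid σ, FreeMonoid.lift (fun _ => Multiplicative.ofAdd (1 : ℤ)) w
        = Multiplicative.ofAdd (w.length : ℤ) := by
      intro w
      rw [FreeMonoid.lift_apply]
      simp only [List.map_const', List.prod_replicate, FreeMonoid.length, ← ofAdd_nsmul, nsmul_eq_mul,
        mul_one]
    rw [this, this, π.homogeneous u v h])

/-- The length morphism `Frac(M) → ℤ`, `[x, y] ↦ |x| - |y|`. -/
noncomputable def HPPresentation.fracLength {σ : Type u} (π : HPPresentation σ) [IsOreMonoid π.Mon] :
    Frac π.Mon →* Multiplicative ℤ where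
  toFun := Quot.lift (fun P => π.lengthHom P.num / π.lengthHom P.den) (by
    rintro P _ ⟨z, r, rfl⟩
    have key : ∀ x y z : π.Mon, π.lengthHom x / π.lengthHom y =
        π.lengthHom (x * z) / π.lengthHom (y * z) := by
      intro x y z
      rw [map_mul, map_mul, mul_div_mul_right_eq_div]
    exact key P.num P.den r)
  map_one' := by
    change π.lengthHom (1 : π.Mon) / π.lengthHom (1 : π.Mon) = 1
    simp
  map_mul' a b := by
    obtain ⟨y, f, g, h, rfl, rfl⟩ := exists_rep₂ a b
    rw [frac_mul_same]
    change π.lengthHom (f : π.Mon) / π.lengthHom (h : π.Mon) =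
      π.lengthHom (f : π.Mon) / π.lengthHom (g : π.Mon) *
        (π.lengthHom (g : π.Mon) / π.lengthHom (h : π.Mon))
    rw [div_mul_div_cancel]

/-- The group `K_M`: the kernel of the length morphism of `Frac(M)`. -/
noncomputable abbrev HPPresentation.K {σ : Type u} (π : HPPresentation σ) [IsOreMonoid π.Mon] :
    Subgroup (Frac π.Mon) := π.fracLength.ker

/-- A generator seen in the fraction group. -/
def HPPresentation.gen {σ : Type u} (π : HPPresentation σ) (a : σ) : Frac π.Mon :=
  Frac.mk (PresentedMonoid.of π.rel a) 1


/-! ### Coloured trees and skein presentations -/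

/-- Finite rooted binary trees with interior vertices coloured by `S` and leaves labelled by `α`. -/
inductive CTree (S : Type u) (α : Type) : Type u
  | leaf (x : α) : CTree S α
  | node (c : S) (l r : CTree S α) : CTree S α

namespace CTree

variable {S : Type u} {α β γ : Type}

/-- The labels of the leaves, from left to right. -/
def leaves : CTree S α → List α
  | leaf x => [x]
  | node _ l r => l.leaves ++ r.leaves

/-- Attach to each leaf the tree indicated by its label. -/
def bind : CTree S α → (α → CTree S β) → CTree S β
  | leaf x, g => g x
  | node c l r, g => node c (l.bind g) (r.bind g)

theorem bind_leaf (t : CTree S α) : t.bind leaf = t := by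
  induction t with
  | leaf => rfl
  | node c l r hl hr => simp [bind, hl, hr]

theorem bind_assoc (t : CTree S α) (g : α → CTree S β) (h : β → CTree S γ) :
    (t.bind g).bind h = t.bind (fun x => (g x).bind h) := by
  induction t with
  | leaf => rfl
  | node c l r hl hr => simp [bind, hl, hr]

theorem leaves_bind (t : CTree S α) (g : α → CTree S β) :
    (t.bind g).leaves = t.leaves.flatMap (fun x => (g x).leaves) := by
  induction t with
  | leaf => simp [bind, leaves]
  | node c l r hl hr => simp [bind, leaves, hl, hr]

end CTree

/-- A skein presentation with colour set `S`: a set of pairs of trees with the same number `n` of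
leaves (numbered `0, …, n-1` from left to right). -/
structure SkeinPresentation (S : Type u) where
  rel : CTree S ℕ → CTree S ℕ → Prop
  numbered : ∀ t s, rel t s → ∃ n, t.leaves = List.range n ∧ s.leaves = List.range n

namespace SkeinPresentation

variable {S : Type u} (P : SkeinPresentation S) {α β : Type}

/-- One application of a skein relation `(t, s)` inside a tree: a subtree `t ∘ g` is replaced
by `s ∘ g`. -/
inductive Step : CTree S α → CTree S α → Prop
  | base {t s : CTree S ℕ} (h : P.rel t s) (g : ℕ → CTree S α) : Step (t.bind g) (s.bind g)
  | left (c : S) {l l' : CTree S α} (r : CTree S α) (h : Step l l') :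
      Step (.node c l r) (.node c l' r)
  | right (c : S) (l : CTree S α) {r r' : CTree S α} (h : Step r r') :
      Step (.node c l r) (.node c l r')

/-- The equivalence relation on trees generated by the skein relations. -/
def TreeEquiv : CTree S α → CTree S α → Prop := Relation.EqvGen P.Step

variable {P}

theorem TreeEquiv.refl (t : CTree S α) : P.TreeEquiv t t := Relation.EqvGen.refl t

theorem TreeEquiv.symm {t s : CTree S α} (h : P.TreeEquiv t s) : P.TreeEquiv s t :=
  Relation.EqvGen.symm _ _ h

theorem TreeEquiv.trans {t s r : CTree S α} (h : P.TreeEquiv t s) (h' : P.TreeEquiv s r) :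
    P.TreeEquiv t r := Relation.EqvGen.trans _ _ _ h h'

theorem TreeEquiv.leaves_eq {t s : CTree S α} (h : P.TreeEquiv t s) : t.leaves = s.leaves := by
  induction h with
  | rel t s h =>
    induction h with
    | base h g =>
      obtain ⟨n, h1, h2⟩ := P.numbered _ _ h
      rw [CTree.leaves_bind, CTree.leaves_bind, h1, h2]
    | left c r h ih => simp [CTree.leaves, ih]
    | right c l h ih => simp [CTree.leaves, ih]
  | refl => rfl
  | symm _ _ _ ih => exact ih.symm
  | trans _ _ _ _ _ h1 h2 => exact h1.trans h2

theorem TreeEquiv.node (c : S) {l l' r r' : CTree S α} (hl : P.TreeEquiv l l')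
    (hr : P.TreeEquiv r r') : P.TreeEquiv (.node c l r) (.node c l' r') := by
  refine TreeEquiv.trans (s := .node c l' r) ?_ ?_
  · induction hl with
    | rel _ _ h => exact .rel _ _ (.left c r h)
    | refl => exact .refl _
    | symm _ _ _ ih => exact ih.symm
    | trans _ _ _ _ _ h1 h2 => exact h1.trans h2
  · induction hr with
    | rel _ _ h => exact .rel _ _ (.right c l' h)
    | refl => exact .refl _
    | symm _ _ _ ih => exact ih.symm
    | trans _ _ _ _ _ h1 h2 => exact h1.trans h2

theorem TreeEquiv.bind {t t' : CTree S α} (h : P.TreeEquiv t t') {g g' : α → CTree S β}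
    (hg : ∀ x, P.TreeEquiv (g x) (g' x)) : P.TreeEquiv (t.bind g) (t'.bind g') := by
  refine TreeEquiv.trans (s := t'.bind g) ?_ ?_
  · induction h with
    | rel _ _ h =>
      apply Relation.EqvGen.rel
      induction h with
      | base h k => rw [CTree.bind_assoc, CTree.bind_assoc]; exact .base h _
      | left c r h ih => exact .left c _ ih
      | right c l h ih => exact .right c _ ih
    | refl => exact .refl _
    | symm _ _ _ ih => exact ih.symm
    | trans _ _ _ _ _ h1 h2 => exact h1.trans h2
  · clear h
    induction t' with
    | leaf x => exact hg x
    | node c l r hl hr => exact hl.node c hr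

end SkeinPresentation

/-! ### Forests with a permutation of their leaves -/

/-- A forest with `n` roots and `m` leaves, with a permutation of the leaves on top of it:
the list of its `n` trees, in which the label of a leaf is the position, on top of the
diagram, of the end of the string attached to this leaf. Every position in `{0, …, m-1}` is used
exactly once. -/
structure VForest (S : Type u) (n m : ℕ) where
  tree : Fin n → CTree S (Fin m)
  perm : ((List.finRange n).flatMap (fun i => (tree i).leaves)).Perm (List.finRange m)

namespace VForest

variable {S : Type u} {n m k : ℕ}

/-- The labels of the leaves of the forest, from left to right. -/
def leaves (f : VForest S n m) : List (Fin m) :=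
  (List.finRange n).flatMap (fun i => (f.tree i).leaves)

/-- The trivial forest. -/
def id (n : ℕ) : VForest S n n where
  tree i := .leaf i
  perm := by simp [CTree.leaves]

theorem leaves_bind (f : VForest S n m) (g : Fin m → CTree S (Fin k)) :
    (List.finRange n).flatMap (fun i => ((f.tree i).bind g).leaves) =
      f.leaves.flatMap (fun j => (g j).leaves) := by
  simp only [CTree.leaves_bind, leaves, List.flatMap_assoc]

/-- Vertical stacking: the `j`-th tree of `g` is attached to the string ending at position `j`. -/
def comp (f : VForest S n m) (g : VForest S m k) : VForest S n k where
  tree i := (f.tree i).bind g.tree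
  perm := by
    rw [leaves_bind]
    exact (f.perm.flatMap_right _).trans g.perm

theorem leaves_comp (f : VForest S n m) (g : VForest S m k) :
    (f.comp g).leaves = f.leaves.flatMap (fun j => (g.tree j).leaves) := leaves_bind f g.tree

/-- The trivial forest with a permutation on top of it: the string starting at position `i` ends at
position `Q i`. -/
def ofPerm (Q : Equiv.Perm (Fin m)) : VForest S m m where
  tree i := .leaf (Q i)
  perm := by
    simp only [CTree.leaves]
    rw [← List.map_eq_flatMap]
    refine (List.perm_ext_iff_of_nodup ((List.nodup_finRange m).map Q.injective)
      (List.nodup_finRange m)).2 fun a => ?_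
    simpa using Q.surjective a

end VForest

/-- Two forests are equivalent modulo the skein relations when their trees are. -/
def forestSetoid {S : Type u} (P : SkeinPresentation S) (n m : ℕ) : Setoid (VForest S n m) where
  r f g := ∀ i, P.TreeEquiv (f.tree i) (g.tree i)
  iseqv := ⟨fun _ _ => .refl _, fun h i => (h i).symm, fun h h' i => (h i).trans (h' i)⟩

/-- Morphisms `n → m` of the category `𝓕^V`. -/
def VHom {S : Type u} (P : SkeinPresentation S) (n m : ℕ) : Type u := Quotient (forestSetoid P n m)

namespace VHom

variable {S : Type u} {P : SkeinPresentation S} {n m k l : ℕ}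

def mk (f : VForest S n m) : VHom P n m := Quotient.mk (forestSetoid P n m) f

theorem ind {motive : VHom P n m → Prop} (h : ∀ f, motive (mk f)) (f : VHom P n m) : motive f :=
  Quotient.ind h f

def id (n : ℕ) : VHom P n n := mk (.id n)

/-- Composition of (classes of) forests. -/
def comp : VHom P n m → VHom P m k → VHom P n k :=
  Quotient.map₂ VForest.comp (fun _ _ h _ _ h' i => (h i).bind h')

theorem mk_comp (f : VForest S n m) (g : VForest S m k) :
    (mk f : VHom P n m).comp (mk g) = mk (f.comp g) := rfl

theorem id_comp (f : VHom P n m) : (id n).comp f = f := by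
  induction f using ind
  rfl

theorem comp_id (f : VHom P n m) : f.comp (id m) = f := by
  induction f using ind with
  | h f =>
    change mk _ = mk _
    congr 1
    cases f
    simp [VForest.comp, VForest.id, CTree.bind_leaf]

theorem comp_assoc (f : VHom P n m) (g : VHom P m k) (h : VHom P k l) :
    (f.comp g).comp h = f.comp (g.comp h) := by
  induction f using ind with
  | h f => induction g using ind with
  | h g => induction h using ind with
  | h h =>
    change mk _ = mk _
    congr 1
    simp [VForest.comp, CTree.bind_assoc]

/-- The labels of the leaves of a forest, from left to right. -/
def leaves : VHom P n m → List (Fin m) :=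
  Quotient.lift VForest.leaves (fun _ _ h => by
    unfold VForest.leaves
    congr 1
    funext i
    exact (h i).leaves_eq)

/-- The labels of the leaves of the `i`-th tree of a forest, from left to right. -/
def treeLeaves : VHom P n m → Fin n → List (Fin m) :=
  Quotient.lift (fun f i => (f.tree i).leaves) (fun _ _ h => funext fun i => (h i).leaves_eq)

theorem leaves_eq_flatMap (f : VHom P n m) :
    f.leaves = (List.finRange n).flatMap f.treeLeaves := by
  induction f using ind
  rfl

theorem leaves_perm (f : VHom P n m) : f.leaves.Perm (List.finRange m) := by
  induction f using ind with
  | h f => exact f.perm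

theorem leaves_comp (f : VHom P n m) (g : VHom P m k) :
    (f.comp g).leaves = f.leaves.flatMap g.treeLeaves := by
  induction f using ind with
  | h f => induction g using ind with
  | h g => exact VForest.leaves_comp f g

theorem leaves_id : (id n : VHom P n n).leaves = List.finRange n := by
  change (VForest.id n).leaves = _
  simp [VForest.id, VForest.leaves, CTree.leaves]

def ofPerm (Q : Equiv.Perm (Fin m)) : VHom P m m := mk (.ofPerm Q)

theorem leaves_ofPerm (Q : Equiv.Perm (Fin m)) :
    (ofPerm Q : VHom P m m).leaves = (List.finRange m).map Q := by
  change (VForest.ofPerm Q).leaves = _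
  simp only [VForest.ofPerm, VForest.leaves, CTree.leaves]
  rw [← List.map_eq_flatMap]

/-- The permutation sending the number of a leaf (from left to right) to the position of the
end of the string attached to it. -/
def ord (f : VHom P n m) : Equiv.Perm (Fin m) :=
  (finCongr (by simpa using f.leaves_perm.length_eq.symm)).trans
    (List.Nodup.getEquivOfForallMemList f.leaves
      (f.leaves_perm.nodup_iff.2 (List.nodup_finRange m))
      (fun x => f.leaves_perm.mem_iff.2 (List.mem_finRange x)))

theorem map_ord (f : VHom P n m) : (List.finRange m).map f.ord = f.leaves := by
  apply List.ext_getElem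
  · simpa using f.leaves_perm.length_eq.symm
  · intro i h1 h2
    simp [ord]

theorem ord_eq_of_leaves {f : VHom P n m} {Q : Equiv.Perm (Fin m)}
    (h : f.leaves = (List.finRange m).map Q) : f.ord = Q := by
  rw [← map_ord] at h
  ext1 i
  exact List.map_inj_left.1 h i (List.mem_finRange i)

theorem ord_ofPerm (Q : Equiv.Perm (Fin m)) : (ofPerm Q : VHom P m m).ord = Q :=
  ord_eq_of_leaves (leaves_ofPerm Q)

theorem ord_id : (id n : VHom P n n).ord = 1 :=
  ord_eq_of_leaves (by rw [leaves_id]; exact (List.map_id _).symm)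

theorem ord_comp (f : VHom P n m) (g : VHom P m k) :
    (f.comp g).ord = ((ofPerm f.ord).comp g).ord := by
  apply ord_eq_of_leaves
  rw [map_ord, leaves_comp, leaves_comp, leaves_ofPerm, map_ord]

end VHom


/-! ### Braid groups and cabling -/

section Braid

variable {m : ℕ}

/-- The positions `i` and `i + 1`. -/
def lo (i : Fin (m - 1)) : Fin m := ⟨i, by omega⟩
def hi (i : Fin (m - 1)) : Fin m := ⟨i + 1, by omega⟩

/-- The transposition of `i` and `i + 1`. -/
def adj (i : Fin (m - 1)) : Equiv.Perm (Fin m) := Equiv.swap (lo i) (hi i)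

open scoped commutatorElement in
/-- Artin's relations: `σᵢσⱼ = σⱼσᵢ` for `|i - j| ≥ 2` and `σᵢσᵢ₊₁σᵢ = σᵢ₊₁σᵢσᵢ₊₁`. -/
inductive BraidRel (m : ℕ) : FreeGroup (Fin (m - 1)) → Prop
  | far (i j : Fin (m - 1)) (h : (i : ℕ) + 2 ≤ j) :
      BraidRel m ⁅FreeGroup.of i, FreeGroup.of j⁆
  | near (i j : Fin (m - 1)) (h : (i : ℕ) + 1 = j) :
      BraidRel m ((FreeGroup.of i * FreeGroup.of j * FreeGroup.of i) *
        (FreeGroup.of j * FreeGroup.of i * FreeGroup.of j)⁻¹)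

/-- The braid group with `m` strands, in Artin's presentation. A product `β * γ` is read from bottom
to top: `γ` is stacked on top of `β`. -/
abbrev BraidGroup (m : ℕ) : Type := PresentedGroup {w | BraidRel m w}

/-- The crossing of the strands in positions `i` and `i + 1`. -/
def braidGen (i : Fin (m - 1)) : BraidGroup m := PresentedGroup.of i

theorem braidGen_far (i j : Fin (m - 1)) (h : (i : ℕ) + 2 ≤ j) :
    braidGen i * braidGen j = braidGen j * braidGen i := by
  have : PresentedGroup.mk {w | BraidRel m w} _ = 1 :=
    PresentedGroup.one_of_mem (BraidRel.far i j h)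
  rwa [map_commutatorElement, commutatorElement_eq_one_iff_mul_comm] at this

theorem braidGen_near (i j : Fin (m - 1)) (h : (i : ℕ) + 1 = j) :
    braidGen i * braidGen j * braidGen i = braidGen j * braidGen i * braidGen j := by
  have := PresentedGroup.mk_eq_mk_of_mul_inv_mem (BraidRel.near i j h : _ ∈ {w | BraidRel m w})
  simp only [map_mul] at this
  exact this

theorem braid_induction {motive : BraidGroup m → Prop} (one : motive 1)
    (gen : ∀ i, motive (braidGen i)) (mul : ∀ x y, motive x → motive y → motive (x * y))
    (inv : ∀ x, motive x → motive x⁻¹) (β : BraidGroup m) : motive β := by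
  have hβ : β ∈ Subgroup.closure (Set.range (PresentedGroup.of (rels := {w | BraidRel m w}))) := by
    rw [PresentedGroup.closure_range_of]; trivial
  induction hβ using Subgroup.closure_induction with
  | mem x hx => obtain ⟨i, rfl⟩ := hx; exact gen i
  | one => exact one
  | mul x y _ _ hx hy => exact mul x y hx hy
  | inv x _ hx => exact inv x hx

theorem adj_lo (i : Fin (m - 1)) : adj i (lo i) = hi i := Equiv.swap_apply_left _ _
theorem adj_hi (i : Fin (m - 1)) : adj i (hi i) = lo i := Equiv.swap_apply_right _ _
theorem adj_mul_self (i : Fin (m - 1)) : adj i * adj i = 1 := Equiv.swap_mul_self _ _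
theorem adj_inv (i : Fin (m - 1)) : (adj i)⁻¹ = adj i := Equiv.swap_inv _ _

theorem adj_val (i : Fin (m - 1)) (p : Fin m) :
    ((p : ℕ) = i ∧ ((adj i p : Fin m) : ℕ) = (i : ℕ) + 1) ∨
      ((p : ℕ) = (i : ℕ) + 1 ∧ ((adj i p : Fin m) : ℕ) = i) ∨
      ((p : ℕ) ≠ i ∧ (p : ℕ) ≠ (i : ℕ) + 1 ∧ ((adj i p : Fin m) : ℕ) = p) := by
  by_cases h1 : p = lo i
  · subst h1; left; exact ⟨rfl, by rw [adj_lo]; rfl⟩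
  by_cases h2 : p = hi i
  · subst h2; right; left; exact ⟨rfl, by rw [adj_hi]; rfl⟩
  · right; right
    refine ⟨fun h => h1 (Fin.ext h), fun h => h2 (Fin.ext h), ?_⟩
    rw [adj, Equiv.swap_apply_of_ne_of_ne h1 h2]

theorem adj_apply_of_ne (i : Fin (m - 1)) (p : Fin m) (h1 : (p : ℕ) ≠ i)
    (h2 : (p : ℕ) ≠ (i : ℕ) + 1) : adj i p = p := by
  have := adj_val i p
  ext
  omega

theorem adj_far (i j : Fin (m - 1)) (h : (i : ℕ) + 2 ≤ j) : adj i * adj j = adj j * adj i := by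
  ext p
  have h1 := adj_val i p
  have h2 := adj_val j p
  have h3 := adj_val i (adj j p)
  have h4 := adj_val j (adj i p)
  simp only [Equiv.Perm.mul_apply]
  omega

theorem hi_eq_lo {i j : Fin (m - 1)} (h : (i : ℕ) + 1 = j) : hi i = lo j := Fin.ext h

theorem adj_near (i j : Fin (m - 1)) (h : (i : ℕ) + 1 = j) :
    adj i * adj j * adj i = adj j * adj i * adj j := by
  have n1 : lo i ≠ lo j := fun e => by have := congrArg Fin.val e; simp only [lo] at this; omega
  have n2 : lo i ≠ hi j := fun e => by have := congrArg Fin.val e; simp only [lo, hi] at this; omega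
  have n3 : hi j ≠ lo j := fun e => by have := congrArg Fin.val e; simp only [lo, hi] at this; omega
  have e1 := Equiv.swap_mul_swap_mul_swap n1 n2
  have e2 := Equiv.swap_mul_swap_mul_swap n3 n2.symm
  unfold adj
  rw [hi_eq_lo h, e1, Equiv.swap_comm (hi j) (lo i), ← e2, Equiv.swap_comm (lo j) (lo i),
    Equiv.swap_comm (hi j) (lo j)]

/-- The morphism from the braid group to the symmetric group sending the `i`-th crossing to the
`i`-th transposition. With the conventions above, the strand of `β` starting at position `p` at the
bottom ends at position `(toPerm β)⁻¹ p` at the top. -/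
def toPerm : BraidGroup m →* Equiv.Perm (Fin m) :=
  PresentedGroup.toGroup (f := adj) (by
    rintro _ (⟨i, j, h⟩ | ⟨i, j, h⟩)
    · rw [map_commutatorElement, commutatorElement_eq_one_iff_mul_comm]
      simpa using adj_far i j h
    · rw [map_mul, map_inv, mul_inv_eq_one]
      simpa using adj_near i j h)

theorem toPerm_gen (i : Fin (m - 1)) : toPerm (braidGen i) = adj i := PresentedGroup.toGroup.of _

/-- A decreasing measure for permutations. -/
def permMeasure (π : Equiv.Perm (Fin m)) : ℕ := ∑ p : Fin m, (p : ℕ) * (m - (π p : ℕ))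

theorem permMeasure_lt {π : Equiv.Perm (Fin m)} {i : Fin (m - 1)} (h : π (hi i) < π (lo i)) :
    permMeasure (π * adj i) < permMeasure π := by
  have e1 : permMeasure (π * adj i) = ∑ p : Fin m, ((adj i p : Fin m) : ℕ) * (m - (π p : ℕ)) := by
    unfold permMeasure
    rw [← Equiv.sum_comp (adj i) (fun p => ((adj i p : Fin m) : ℕ) * (m - (π p : ℕ)))]
    refine Finset.sum_congr rfl fun p _ => ?_
    rw [← Equiv.Perm.mul_apply (adj i) (adj i), adj_mul_self]
    rfl
  rw [e1]
  unfold permMeasure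
  zify
  rw [← sub_neg, ← Finset.sum_sub_distrib]
  rw [Fintype.sum_eq_add (lo i) (hi i)]
  · rw [adj_lo, adj_hi]
    have h1 : ((π (hi i) : Fin m) : ℕ) < (π (lo i) : Fin m) := h
    have h2 := (π (lo i)).isLt
    have h3 := (π (hi i)).isLt
    rw [Nat.cast_sub h2.le, Nat.cast_sub h3.le]
    simp only [lo, hi] at h1 ⊢
    push_cast
    have h4 : ((π ⟨(i : ℕ) + 1, by omega⟩ : Fin m) : ℤ) < ((π ⟨(i : ℕ), by omega⟩ : Fin m) : ℤ) := by
      exact_mod_cast h1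
    linarith
  · simp [lo, hi, Fin.ext_iff]
  · rintro p ⟨hp1, hp2⟩
    have : adj i p = p := Equiv.swap_apply_of_ne_of_ne hp1 hp2
    rw [this, sub_self]

open Classical in
/-- The positive permutation braid of `π`: the strand starting at position `p` ends at
position `π p`, all crossings are positive and any two strands cross at most once. It is obtained by
performing a crossing of two neighbouring strands that have to cross, as long as there are some. -/
noncomputable def posLift (π : Equiv.Perm (Fin m)) : BraidGroup m :=
  if h : ∃ i, π (hi i) < π (lo i) then braidGen h.choose * posLift (π * adj h.choose) else 1
termination_by permMeasure π
decreasing_by exact permMeasure_lt h.choose_spec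

theorem posLift_aux {π : Equiv.Perm (Fin m)}
    (ih : ∀ π' : Equiv.Perm (Fin m), permMeasure π' < permMeasure π →
      ∀ i, π' (hi i) < π' (lo i) → posLift π' = braidGen i * posLift (π' * adj i))
    {i j : Fin (m - 1)} (hi' : π (hi i) < π (lo i)) (hj : π (hi j) < π (lo j)) (hij : i < j) :
    braidGen i * posLift (π * adj i) = braidGen j * posLift (π * adj j) := by
  have hij' : (i : ℕ) < j := hij
  by_cases hfar : (i : ℕ) + 2 ≤ j
  · have e1 : adj i (lo j) = lo j := by
      apply adj_apply_of_ne <;> simp only [lo] <;> omega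
    have e2 : adj i (hi j) = hi j := by
      apply adj_apply_of_ne <;> simp only [hi] <;> omega
    have e3 : adj j (lo i) = lo i := by
      apply adj_apply_of_ne <;> simp only [lo] <;> omega
    have e4 : adj j (hi i) = hi i := by
      apply adj_apply_of_ne <;> simp only [hi] <;> omega
    rw [ih _ (permMeasure_lt hi') j (by simpa [Equiv.Perm.mul_apply, e1, e2] using hj),
      ih _ (permMeasure_lt hj) i (by simpa [Equiv.Perm.mul_apply, e3, e4] using hi'),
      mul_assoc π, mul_assoc π, adj_far i j hfar, ← mul_assoc, ← mul_assoc (braidGen j),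
      braidGen_far i j hfar]
  · have hn : (i : ℕ) + 1 = j := by omega
    have hl : lo j = hi i := by ext; simp [lo, hi, hn]
    have e1 : adj i (hi j) = hi j := by
      apply adj_apply_of_ne <;> simp only [hi] <;> omega
    have e3 : adj j (lo i) = lo i := by
      apply adj_apply_of_ne <;> simp only [lo] <;> omega
    have e5 : adj i (lo j) = lo i := by rw [hl, adj_hi]
    have e6 : adj j (hi i) = hi j := by rw [← hl, adj_lo]
    rw [hl] at hj
    have d1 : (π * adj i) (hi j) < (π * adj i) (lo j) := by
      simp only [Equiv.Perm.mul_apply, e1, e5]; exact hj.trans hi'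
    have d2 : (π * adj i * adj j) (hi i) < (π * adj i * adj j) (lo i) := by
      simp only [Equiv.Perm.mul_apply, e6, e1, e3, adj_lo]; exact hj
    have d3 : (π * adj j) (hi i) < (π * adj j) (lo i) := by
      simp only [Equiv.Perm.mul_apply, e6, e3]; exact hj.trans hi'
    have d4 : (π * adj j * adj i) (hi j) < (π * adj j * adj i) (lo j) := by
      simp only [Equiv.Perm.mul_apply, e1, adj_hi, e5, e3]; rw [hl] at *; exact hi'
    have hj2 : π (hi j) < π (lo j) := by rw [hl]; exact hj
    rw [ih _ (permMeasure_lt hi') j d1,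
      ih _ ((permMeasure_lt d1).trans (permMeasure_lt hi')) i d2,
      ih _ (permMeasure_lt hj2) i d3,
      ih _ ((permMeasure_lt d3).trans (permMeasure_lt hj2)) j d4]
    have key : π * adj i * adj j * adj i = π * adj j * adj i * adj j := by
      simp only [mul_assoc]; rw [← mul_assoc (adj i), adj_near i j hn, mul_assoc]
    rw [key]
    simp only [← mul_assoc]
    rw [braidGen_near i j hn]

theorem posLift_of_descent (π : Equiv.Perm (Fin m)) (i : Fin (m - 1)) (h : π (hi i) < π (lo i)) :
    posLift π = braidGen i * posLift (π * adj i) := by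
  induction hN : permMeasure π using Nat.strong_induction_on generalizing π i with
  | _ N ih =>
    subst hN
    have ih' : ∀ π' : Equiv.Perm (Fin m), permMeasure π' < permMeasure π →
        ∀ i, π' (hi i) < π' (lo i) → posLift π' = braidGen i * posLift (π' * adj i) :=
      fun π' hπ' i hi' => ih _ hπ' π' i hi' rfl
    have hex : ∃ i, π (hi i) < π (lo i) := ⟨i, h⟩
    have e : posLift π = braidGen hex.choose * posLift (π * adj hex.choose) := by
      rw [posLift, dif_pos hex]
    rw [e]
    rcases lt_trichotomy hex.choose i with hlt | heq | hgt
    · exact posLift_aux ih' hex.choose_spec h hlt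
    · rw [heq]
    · exact (posLift_aux ih' h hex.choose_spec hgt).symm

theorem eq_one_of_no_descent {π : Equiv.Perm (Fin m)} (h : ¬ ∃ i, π (hi i) < π (lo i)) : π = 1 := by
  push Not at h
  have mono : StrictMono π := by
    have key : ∀ d : ℕ, ∀ p q : Fin m, (p : ℕ) + d = q → π p ≤ π q := by
      intro d
      induction d with
      | zero => intro p q hpq; rw [show p = q from Fin.ext (by simpa using hpq)]
      | succ d ih =>
        intro p q hpq
        have h1 := ih p ⟨p + d, by omega⟩ rfl
        have h2 := h ⟨p + d, by omega⟩
        have : hi (⟨p + d, by omega⟩ : Fin (m - 1)) = q := Fin.ext (by simp [hi]; omega)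
        rw [this] at h2
        exact h1.trans h2
    intro p q hpq
    refine lt_of_le_of_ne (key (q - p) p q ?_) (fun e => hpq.ne (π.injective e))
    have : (p : ℕ) < q := hpq
    omega
  have : (mono.orderIsoOfSurjective π π.surjective) = OrderIso.refl _ := Subsingleton.elim _ _
  ext p
  exact congrArg Fin.val (congrArg (fun e : Fin m ≃o Fin m => e p) this)

theorem posLift_one : posLift (1 : Equiv.Perm (Fin m)) = 1 := by
  rw [posLift, dif_neg]
  rintro ⟨i, h⟩
  have : (i : ℕ) + 1 < i := h
  omega

theorem adj_descent (i : Fin (m - 1)) : adj i (hi i) < adj i (lo i) := by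
  rw [adj_lo, adj_hi]
  exact Fin.mk_lt_mk.2 (Nat.lt_succ_self _)

theorem posLift_adj (i : Fin (m - 1)) : posLift (adj i) = braidGen i := by
  rw [posLift_of_descent _ i (adj_descent i), adj_mul_self, posLift_one, mul_one]

theorem perm_induction {motive : Equiv.Perm (Fin m) → Prop} (one : motive 1)
    (step : ∀ π i, π (hi i) < π (lo i) → motive (π * adj i) → motive π) (π : Equiv.Perm (Fin m)) :
    motive π := by
  induction hN : permMeasure π using Nat.strong_induction_on generalizing π with
  | _ N ih =>
    subst hN
    by_cases h : ∃ i, π (hi i) < π (lo i)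
    · obtain ⟨i, h⟩ := h
      exact step π i h (ih _ (permMeasure_lt h) _ rfl)
    · rw [eq_one_of_no_descent h]; exact one

/-- The strand of the positive lift of `π` starting at `p` ends at `π p`. -/
theorem toPerm_posLift (π : Equiv.Perm (Fin m)) : (toPerm (posLift π))⁻¹ = π := by
  induction π using perm_induction with
  | one => rw [posLift_one, map_one, inv_one]
  | step π i h ih =>
    rw [posLift_of_descent π i h, map_mul, toPerm_gen, mul_inv_rev, ih, adj_inv, mul_assoc,
      adj_mul_self, mul_one]

/-- No pair of strands crosses in `π` and crosses back in `τ`. -/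
def NoDouble (π τ : Equiv.Perm (Fin m)) : Prop :=
  ∀ p q, p < q → π q < π p → τ (π q) < τ (π p)

theorem noDouble_adj {i : Fin (m - 1)} {τ : Equiv.Perm (Fin m)} (h : τ (lo i) < τ (hi i)) :
    NoDouble (adj i) τ := by
  intro p q hpq hlt
  have h1 : (p : ℕ) < q := hpq
  have h2 : ((adj i q : Fin m) : ℕ) < adj i p := hlt
  have h3 := adj_val i p
  have h4 := adj_val i q
  have hp : p = lo i := by ext; simp only [lo]; omega
  have hq : q = hi i := by ext; simp only [hi]; omega
  rw [hp, hq, adj_lo, adj_hi]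
  exact h

theorem noDouble_adj_mul {i : Fin (m - 1)} {π : Equiv.Perm (Fin m)} (h : π (hi i) < π (lo i)) :
    NoDouble (adj i) (π * adj i) :=
  noDouble_adj (by simpa [Equiv.Perm.mul_apply, adj_lo, adj_hi] using h)

theorem noDouble_step {π τ : Equiv.Perm (Fin m)} (h : NoDouble π τ) {i : Fin (m - 1)}
    (hi' : π (hi i) < π (lo i)) : NoDouble (π * adj i) τ := by
  intro p q hpq hlt
  simp only [Equiv.Perm.mul_apply] at hlt ⊢
  apply h _ _ _ hlt
  have h1 : (p : ℕ) < q := hpq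
  by_contra hc
  have h2 : ((adj i q : Fin m) : ℕ) ≤ adj i p := not_lt.1 hc
  have h3 := adj_val i p
  have h4 := adj_val i q
  have hp : p = lo i := by ext; simp only [lo]; omega
  have hq : q = hi i := by ext; simp only [hi]; omega
  rw [hp, hq, adj_lo, adj_hi] at hlt
  exact absurd hlt hi'.asymm

theorem posLift_mul {π τ : Equiv.Perm (Fin m)} (h : NoDouble π τ) :
    posLift π * posLift τ = posLift (τ * π) := by
  induction π using perm_induction with
  | one => rw [posLift_one, one_mul, mul_one]
  | step π i hd ih =>
    have hlt : lo i < hi i := Fin.mk_lt_mk.2 (Nat.lt_succ_self _)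
    rw [posLift_of_descent π i hd, mul_assoc, ih (noDouble_step h hd),
      posLift_of_descent (τ * π) i (h _ _ hlt hd), mul_assoc τ π]

end Braid

section Cabling

variable {S : Type u} {P : SkeinPresentation S} {m k l : ℕ}

/-- The order of the leaves of the forest obtained from `g` by placing its tree `Q i` in
position `i`. -/
def blockOrd (g : VHom P m k) (Q : Equiv.Perm (Fin m)) : Equiv.Perm (Fin k) :=
  ((VHom.ofPerm Q).comp g).ord

/-- The permutation braid obtained from `π` by replacing the strand ending at position `p` by
parallel strands, one for each leaf of the tree `Q p` of `g`. -/
noncomputable def blockLift (g : VHom P m k) (Q π : Equiv.Perm (Fin m)) : BraidGroup k :=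
  posLift ((blockOrd g Q)⁻¹ * blockOrd g (Q * π))

theorem map_blockOrd (g : VHom P m k) (Q : Equiv.Perm (Fin m)) :
    (List.finRange k).map (blockOrd g Q) =
      (List.finRange m).flatMap (fun p => g.treeLeaves (Q p)) := by
  rw [blockOrd, VHom.map_ord, VHom.leaves_comp, VHom.leaves_ofPerm, List.flatMap_map]

theorem pairwise_finRange {n : ℕ} (R : Fin n → Fin n → Prop) :
    (List.finRange n).Pairwise R ↔ ∀ p q, p < q → R p q := by
  rw [List.pairwise_iff_getElem]
  constructor
  · intro h p q hpq
    simpa using h p q (by simp) (by simp) hpq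
  · intro h p q hp hq hpq
    simpa using h _ _ (by simpa using hpq)

theorem pairwise_blockOrd (g : VHom P m k) (Q : Equiv.Perm (Fin m)) (R : Fin k → Fin k → Prop) :
    (∀ p q, p < q → R (blockOrd g Q p) (blockOrd g Q q)) ↔
      (∀ i, (g.treeLeaves i).Pairwise R) ∧
        ∀ p q, p < q → ∀ x ∈ g.treeLeaves (Q p), ∀ y ∈ g.treeLeaves (Q q), R x y := by
  rw [← pairwise_finRange (fun p q => R (blockOrd g Q p) (blockOrd g Q q)), ← List.pairwise_map, map_blockOrd,
    List.pairwise_flatMap, pairwise_finRange]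
  refine and_congr_left fun _ => ⟨fun h i => ?_, fun h p _ => h (Q p)⟩
  simpa using h (Q.symm i) (List.mem_finRange _)

theorem blockOrd_before (g : VHom P m k) (Q : Equiv.Perm (Fin m)) :
    (∀ i, (g.treeLeaves i).Pairwise (fun x y => (blockOrd g Q)⁻¹ x < (blockOrd g Q)⁻¹ y)) ∧
      ∀ p q, p < q → ∀ x ∈ g.treeLeaves (Q p), ∀ y ∈ g.treeLeaves (Q q),
        (blockOrd g Q)⁻¹ x < (blockOrd g Q)⁻¹ y := by
  rw [← pairwise_blockOrd]
  intro p q hpq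
  simpa using hpq

theorem noDouble_block (g : VHom P m k) (Q : Equiv.Perm (Fin m)) {π τ : Equiv.Perm (Fin m)}
    (h : NoDouble π τ) :
    NoDouble ((blockOrd g (Q * τ))⁻¹ * blockOrd g (Q * τ * π))
      ((blockOrd g Q)⁻¹ * blockOrd g (Q * τ)) := by
  obtain ⟨a1, b1⟩ := blockOrd_before g (Q * τ)
  obtain ⟨_, b2⟩ := blockOrd_before g Q
  have := (pairwise_blockOrd g (Q * τ * π) (fun x y =>
    (blockOrd g (Q * τ))⁻¹ y < (blockOrd g (Q * τ))⁻¹ x → (blockOrd g Q)⁻¹ y < (blockOrd g Q)⁻¹ x)).2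
    ⟨fun i => (a1 i).imp fun hxy hyx => absurd hxy hyx.asymm, by
      intro p q hpq x hx y hy hyx
      simp only [Equiv.Perm.mul_apply] at hx hy
      rcases lt_trichotomy (π p) (π q) with hlt | heq | hgt
      · exact absurd (b1 _ _ hlt x (by simpa using hx) y (by simpa using hy)) hyx.asymm
      · exact absurd (π.injective heq) hpq.ne
      · exact b2 _ _ (h p q hpq hgt) y hy x hx⟩
  intro p q hpq hlt
  simp only [Equiv.Perm.mul_apply] at hlt ⊢
  rw [Equiv.Perm.inv_def (blockOrd g (Q * τ)), Equiv.apply_symm_apply, Equiv.apply_symm_apply]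
  exact this p q hpq hlt

theorem blockLift_mul (g : VHom P m k) (Q : Equiv.Perm (Fin m)) {π τ : Equiv.Perm (Fin m)}
    (h : NoDouble π τ) : blockLift g (Q * τ) π * blockLift g Q τ = blockLift g Q (τ * π) := by
  unfold blockLift
  rw [posLift_mul (noDouble_block g Q h), ← mul_assoc Q]
  congr 1
  group

/-- The cabling of one crossing, as a bijection: it acts on pairs `(Q, x)` consisting of an
order `Q` of the trees of `g` on top of the crossing and a braid `x` on the leaves. -/
noncomputable def cableGen (g : VHom P m k) (i : Fin (m - 1)) :
    Equiv.Perm (Equiv.Perm (Fin m) × BraidGroup k) where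
  toFun a := (a.1 * adj i, blockLift g a.1 (adj i) * a.2)
  invFun a := (a.1 * adj i, (blockLift g (a.1 * adj i) (adj i))⁻¹ * a.2)
  left_inv a := by simp [mul_assoc, adj_mul_self]
  right_inv a := by simp [mul_assoc, adj_mul_self]

/-- The action of braids by cabling. -/
noncomputable def cableHom (g : VHom P m k) :
    BraidGroup m →* Equiv.Perm (Equiv.Perm (Fin m) × BraidGroup k) :=
  PresentedGroup.toGroup (f := cableGen g) (by
    have hlt : ∀ i : Fin (m - 1), lo i < hi i := fun i => Fin.mk_lt_mk.2 (Nat.lt_succ_self _)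
    have two : ∀ (i j : Fin (m - 1)), i ≠ j → ∀ Q : Equiv.Perm (Fin m),
        blockLift g (Q * adj j) (adj i) * blockLift g Q (adj j) =
          blockLift g Q (adj j * adj i) := by
      intro i j hij Q
      apply blockLift_mul
      apply noDouble_adj
      have : (i : ℕ) ≠ j := fun h => hij (Fin.ext h)
      have h1 := adj_val j (lo i)
      have h2 := adj_val j (hi i)
      rw [Fin.lt_def]
      simp only [lo, hi] at h1 h2 ⊢
      omega
    rintro _ (⟨i, j, h⟩ | ⟨i, j, h⟩)
    · rw [map_commutatorElement, commutatorElement_eq_one_iff_mul_comm]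
      simp only [FreeGroup.lift_apply_of]
      ext1 ⟨Q, x⟩
      have hij : i ≠ j := fun e => by subst e; omega
      simp only [Equiv.Perm.mul_apply, cableGen, Equiv.coe_fn_mk]
      refine Prod.ext ?_ ?_
      · simp only [mul_assoc, adj_far i j h]
      · simp only
        rw [← mul_assoc, two i j hij, ← mul_assoc, two j i hij.symm, adj_far i j h]
    · rw [map_mul, map_inv, mul_inv_eq_one]
      simp only [map_mul, FreeGroup.lift_apply_of]
      ext1 ⟨Q, x⟩
      have hij : i ≠ j := fun e => by subst e; omega
      have e1 := adj_near i j h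
      have t1 : ∀ Q : Equiv.Perm (Fin m), blockLift g (Q * (adj i * adj j)) (adj i) *
          blockLift g Q (adj i * adj j) = blockLift g Q (adj i * adj j * adj i) := by
        intro Q
        apply blockLift_mul
        apply noDouble_adj
        rw [Equiv.Perm.mul_apply, Equiv.Perm.mul_apply, hi_eq_lo h, adj_lo,
          adj_apply_of_ne j (lo i) (by simp only [lo]; omega) (by simp only [lo]; omega), adj_lo,
          adj_apply_of_ne i (hi j) (by simp only [hi]; omega) (by simp only [hi]; omega)]
        simp only [hi, Fin.mk_lt_mk]
        omega
      have t2 : ∀ Q : Equiv.Perm (Fin m), blockLift g (Q * (adj j * adj i)) (adj j) *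
          blockLift g Q (adj j * adj i) = blockLift g Q (adj j * adj i * adj j) := by
        intro Q
        apply blockLift_mul
        apply noDouble_adj
        rw [Equiv.Perm.mul_apply, Equiv.Perm.mul_apply, ← hi_eq_lo h, adj_hi,
          adj_apply_of_ne i (hi j) (by simp only [hi]; omega) (by simp only [hi]; omega), adj_hi,
          adj_apply_of_ne j (lo i) (by simp only [lo]; omega) (by simp only [lo]; omega)]
        simp only [lo, Fin.mk_lt_mk]
        omega
      simp only [Equiv.Perm.mul_apply, cableGen, Equiv.coe_fn_mk]
      refine Prod.ext ?_ ?_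
      · simp only [mul_assoc] at e1 ⊢
        rw [e1]
      · simp only [mul_assoc Q]
        rw [← mul_assoc (blockLift g (Q * adj i) (adj j)), two j i hij.symm, ← mul_assoc, t1,
          ← mul_assoc (blockLift g (Q * adj j) (adj i)), two i j hij, ← mul_assoc _ _ x, t2, e1])

/-- The cabled braid `β^g`: the strand of `β` ending at position `p` on top is replaced by
parallel strands, one for each leaf of the tree `Q p` of `g`. -/
noncomputable def cable (g : VHom P m k) (β : BraidGroup m) (Q : Equiv.Perm (Fin m)) :
    BraidGroup k := (cableHom g β (Q, 1)).2

theorem cableHom_apply (g : VHom P m k) (β : BraidGroup m) (Q : Equiv.Perm (Fin m))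
    (x : BraidGroup k) : cableHom g β (Q, x) = (Q * (toPerm β)⁻¹, cable g β Q * x) := by
  suffices h : ∀ (Q : Equiv.Perm (Fin m)), ∃ c, ∀ x, cableHom g β (Q, x) = (Q * (toPerm β)⁻¹, c * x)
  by
    obtain ⟨c, hc⟩ := h Q
    rw [cable, hc, hc, mul_one]
  clear Q x
  induction β using braid_induction with
  | one => exact fun Q => ⟨1, fun x => by simp⟩
  | gen i =>
    intro Q
    refine ⟨blockLift g Q (adj i), fun x => ?_⟩
    rw [toPerm_gen, adj_inv, cableHom, braidGen, PresentedGroup.toGroup.of]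
    rfl
  | mul β γ hβ hγ =>
    intro Q
    obtain ⟨c, hc⟩ := hγ Q
    obtain ⟨d, hd⟩ := hβ (Q * (toPerm γ)⁻¹)
    refine ⟨d * c, fun x => ?_⟩
    rw [map_mul, Equiv.Perm.mul_apply, hc, hd, map_mul, mul_inv_rev, mul_assoc, mul_assoc]
  | inv β hβ =>
    intro Q
    obtain ⟨c, hc⟩ := hβ (Q * toPerm β)
    refine ⟨c⁻¹, fun x => ?_⟩
    rw [map_inv, Equiv.Perm.inv_eq_iff_eq, map_inv, inv_inv, hc]
    simp

theorem cable_one (g : VHom P m k) (Q : Equiv.Perm (Fin m)) : cable g 1 Q = 1 := by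
  simp [cable]

theorem cable_gen (g : VHom P m k) (i : Fin (m - 1)) (Q : Equiv.Perm (Fin m)) :
    cable g (braidGen i) Q = blockLift g Q (adj i) := by
  rw [cable, cableHom, braidGen, PresentedGroup.toGroup.of]
  exact mul_one _

theorem cable_mul (g : VHom P m k) (β γ : BraidGroup m) (Q : Equiv.Perm (Fin m)) :
    cable g (β * γ) Q = cable g β (Q * (toPerm γ)⁻¹) * cable g γ Q := by
  rw [cable, map_mul, Equiv.Perm.mul_apply, cableHom_apply g γ, cableHom_apply, mul_one]

theorem cable_inv (g : VHom P m k) (β : BraidGroup m) (Q : Equiv.Perm (Fin m)) :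
    cable g β⁻¹ Q = (cable g β (Q * toPerm β))⁻¹ := by
  have := cable_mul g β β⁻¹ Q
  rw [mul_inv_cancel, cable_one, map_inv, inv_inv] at this
  exact (inv_eq_of_mul_eq_one_right this.symm).symm

theorem toPerm_cable (g : VHom P m k) (β : BraidGroup m) (Q : Equiv.Perm (Fin m)) :
    (toPerm (cable g β Q))⁻¹ = (blockOrd g Q)⁻¹ * blockOrd g (Q * (toPerm β)⁻¹) := by
  induction β using braid_induction generalizing Q with
  | one => simp [cable_one]
  | gen i => rw [cable_gen, blockLift, toPerm_posLift, toPerm_gen, adj_inv]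
  | mul β γ hβ hγ =>
    rw [cable_mul, map_mul, mul_inv_rev, hβ, hγ, map_mul, mul_inv_rev, mul_assoc Q]
    group
  | inv β hβ =>
    rw [cable_inv, map_inv, hβ, map_inv, inv_inv, mul_assoc, mul_inv_cancel, mul_one, mul_inv_rev,
      inv_inv]

theorem cable_posLift (g : VHom P m k) (π Q : Equiv.Perm (Fin m)) :
    cable g (posLift π) Q = blockLift g Q π := by
  induction π using perm_induction with
  | one => rw [posLift_one, cable_one, blockLift, mul_one, inv_mul_cancel, posLift_one]
  | step π i h ih =>
    rw [posLift_of_descent π i h, cable_mul, ih, toPerm_posLift, cable_gen,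
      blockLift_mul g Q (noDouble_adj_mul h), mul_assoc, adj_mul_self, mul_one]

theorem blockOrd_one (g : VHom P m k) : blockOrd g 1 = g.ord := by
  rw [blockOrd, show (VHom.ofPerm 1 : VHom P m m) = VHom.id m from rfl, VHom.id_comp]

theorem blockOrd_comp (g : VHom P m k) (h : VHom P k l) (Q : Equiv.Perm (Fin m)) :
    blockOrd (g.comp h) Q = blockOrd h (blockOrd g Q) := by
  unfold blockOrd
  rw [← VHom.comp_assoc, VHom.ord_comp]

theorem cable_comp (g : VHom P m k) (h : VHom P k l) (β : BraidGroup m) (Q : Equiv.Perm (Fin m)) :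
    cable h (cable g β Q) (blockOrd g Q) = cable (g.comp h) β Q := by
  induction β using braid_induction generalizing Q with
  | one => simp [cable_one]
  | gen i =>
    rw [cable_gen, cable_gen, blockLift, cable_posLift, blockLift, blockLift, blockOrd_comp,
      blockOrd_comp, mul_inv_cancel_left]
  | mul β γ hβ hγ =>
    rw [cable_mul, cable_mul, cable_mul, hγ, toPerm_cable, mul_inv_cancel_left, hβ]
  | inv β hβ =>
    have e := toPerm_cable g β (Q * toPerm β)
    rw [mul_inv_cancel_right] at e
    rw [cable_inv, cable_inv, cable_inv, ← hβ, ← inv_inv (toPerm (cable g β (Q * toPerm β))), e,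
      mul_inv_rev, inv_inv, mul_inv_cancel_left]

theorem cable_id (β : BraidGroup m) (Q : Equiv.Perm (Fin m)) :
    cable (VHom.id m : VHom P m m) β Q = β := by
  have e : ∀ Q, blockOrd (VHom.id m : VHom P m m) Q = Q := by
    intro Q
    rw [blockOrd, VHom.comp_id, VHom.ord_ofPerm]
  induction β using braid_induction generalizing Q with
  | one => exact cable_one _ _
  | gen i => rw [cable_gen, blockLift, e, e, inv_mul_cancel_left, posLift_adj]
  | mul β γ hβ hγ => rw [cable_mul, hβ, hγ]
  | inv β hβ => rw [cable_inv, hβ]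

end Cabling


/-! ### Forest-skein categories -/

/-- The four versions of a forest-skein category. -/
inductive ThompsonType
  | F | T | V | BV

/-- Morphisms `n → m` in the `X`-version of the forest-skein category: classes of forests with
`n` roots and `m` leaves, with on top of them nothing (`F`), a cyclic permutation (`T`),
a permutation (`V`), or a braid (`BV`). -/
def FSHom {S : Type u} (P : SkeinPresentation S) : ThompsonType → ℕ → ℕ → Type u
  | .F, n, m => {f : VHom P n m // f.leaves = List.finRange m}
  | .T, n, m => {f : VHom P n m // f.leaves.IsRotated (List.finRange m)}
  | .V, n, m => VHom P n m
  | .BV, n, m => {p : VHom P n m × BraidGroup m // (toPerm p.2)⁻¹ = p.1.ord}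

namespace FSHom

variable {S : Type u} {P : SkeinPresentation S}

theorem isRotated_flatMap {α β : Type} {l l' : List α} (h : l.IsRotated l') (g : α → List β) :
    (l.flatMap g).IsRotated (l'.flatMap g) := by
  obtain ⟨n, rfl⟩ := h
  rw [List.rotate_eq_drop_append_take_mod, List.flatMap_append]
  conv_lhs => rw [← List.take_append_drop (n % l.length) l, List.flatMap_append]
  exact List.isRotated_append

def id : (X : ThompsonType) → (n : ℕ) → FSHom P X n n
  | .F, n => ⟨VHom.id n, VHom.leaves_id⟩
  | .T, n => ⟨VHom.id n, by rw [VHom.leaves_id]⟩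
  | .V, n => VHom.id n
  | .BV, n => ⟨(VHom.id n, 1), by rw [map_one, inv_one, VHom.ord_id]⟩

/-- Vertical stacking of diagrams. For `BV` this is `(f, β)(g, γ) = (f ∘ (g permuted by β), β^g γ)`
where `β^g` is the cabling of `β` along `g`. -/
noncomputable def comp : (X : ThompsonType) → {n m k : ℕ} → FSHom P X n m → FSHom P X m k →
    FSHom P X n k
  | .F, _, m, k, f, g => ⟨f.1.comp g.1, by
      rw [VHom.leaves_comp, f.2, ← VHom.leaves_eq_flatMap, g.2]⟩
  | .T, _, m, k, f, g => ⟨f.1.comp g.1, by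
      rw [VHom.leaves_comp]
      refine (isRotated_flatMap f.2 _).trans ?_
      rw [← VHom.leaves_eq_flatMap]
      exact g.2⟩
  | .V, _, _, _, f, g => VHom.comp f g
  | .BV, _, _, _, f, g => ⟨(f.1.1.comp g.1.1, cable g.1.1 f.1.2 1 * g.1.2), by
      rw [map_mul, mul_inv_rev, toPerm_cable, g.2, f.2, blockOrd_one, mul_inv_cancel_left, one_mul]
      exact (VHom.ord_comp _ _).symm⟩

theorem id_comp (X : ThompsonType) {n m : ℕ} (f : FSHom P X n m) : comp X (id X n) f = f := by
  cases X with
  | F => exact Subtype.ext (VHom.id_comp _)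
  | T => exact Subtype.ext (VHom.id_comp _)
  | V => exact VHom.id_comp _
  | BV =>
    refine Subtype.ext (Prod.ext (VHom.id_comp _) ?_)
    change cable f.1.1 1 1 * f.1.2 = f.1.2
    rw [cable_one, one_mul]

theorem comp_id (X : ThompsonType) {n m : ℕ} (f : FSHom P X n m) : comp X f (id X m) = f := by
  cases X with
  | F => exact Subtype.ext (VHom.comp_id _)
  | T => exact Subtype.ext (VHom.comp_id _)
  | V => exact VHom.comp_id _
  | BV =>
    refine Subtype.ext (Prod.ext (VHom.comp_id _) ?_)
    change cable (VHom.id m : VHom P m m) f.1.2 1 * 1 = f.1.2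
    rw [cable_id, mul_one]

theorem comp_assoc (X : ThompsonType) {n m k l : ℕ} (f : FSHom P X n m) (g : FSHom P X m k)
    (h : FSHom P X k l) : comp X (comp X f g) h = comp X f (comp X g h) := by
  cases X with
  | F => exact Subtype.ext (VHom.comp_assoc _ _ _)
  | T => exact Subtype.ext (VHom.comp_assoc _ _ _)
  | V => exact VHom.comp_assoc _ _ _
  | BV =>
    refine Subtype.ext (Prod.ext (VHom.comp_assoc _ _ _) ?_)
    change cable h.1.1 (cable g.1.1 f.1.2 1 * g.1.2) 1 * h.1.2 =
      cable (g.1.1.comp h.1.1) f.1.2 1 * (cable h.1.1 g.1.2 1 * h.1.2)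
    rw [cable_mul, one_mul, g.2, ← blockOrd_one, cable_comp, mul_assoc]

end FSHom

/-- The `X`-version of the forest-skein category of the skein presentation `P`. The objects are the
natural numbers. -/
structure FSCat {S : Type u} (P : SkeinPresentation S) (X : ThompsonType) : Type where
  n : ℕ

noncomputable instance {S : Type u} (P : SkeinPresentation S) (X : ThompsonType) :
    Category.{u} (FSCat P X) where
  Hom n m := FSHom P X n.n m.n
  id n := FSHom.id X n.n
  comp f g := FSHom.comp X f g
  id_comp f := FSHom.id_comp X f
  comp_id f := FSHom.comp_id X f
  assoc f g h := FSHom.comp_assoc X f g h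

/-- The functor from the `X`-version to the `V`-version: the inclusion for `F`, `T`, `V`, and for `BV`
the functor replacing a braid by its permutation. -/
noncomputable def toV {S : Type u} (P : SkeinPresentation S) : (X : ThompsonType) → FSCat P X ⥤ FSCat P .V
  | .F => { obj n := ⟨n.n⟩, map f := f.1 }
  | .T => { obj n := ⟨n.n⟩, map f := f.1 }
  | .V => 𝟭 _
  | .BV => { obj n := ⟨n.n⟩, map f := f.1.1 }

/-- The forest-skein group `G^X`: the fraction group at the object `1`. -/
abbrev FSGroup {S : Type u} (P : SkeinPresentation S) (X : ThompsonType) : Type u :=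
  FracGroup (FSCat P X) ⟨1⟩

/-- The left-vine coloured by a word, read from the root to the first leaf, with leaves numbered from
left to right. -/
def leftVine {S : Type u} : List S → CTree S ℕ
  | [] => .leaf 0
  | c :: w => .node c (leftVine w) (.leaf (w.length + 1))

theorem leaves_leftVine {S : Type u} (w : List S) :
    (leftVine w).leaves = List.range (w.length + 1) := by
  induction w with
  | nil => rfl
  | cons c w ih => rw [leftVine, CTree.leaves, ih, CTree.leaves, List.length_cons, ← List.range_succ]

/-- The skein presentation of `𝓕_M` for `M = Mon⟨σ | ρ⟩`: the colours are the generators, and the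
relations are the pairs of left-vines coloured by the two sides of a relation of `M`. -/
def HPPresentation.skein {σ : Type u} (π : HPPresentation σ) : SkeinPresentation σ where
  rel t s := ∃ w w' : FreeMonoid σ, π.rel w w' ∧ t = leftVine w.toList ∧ s = leftVine w'.toList
  numbered := by
    rintro _ _ ⟨w, w', h, rfl, rfl⟩
    refine ⟨w.length + 1, leaves_leftVine _, ?_⟩
    rw [leaves_leftVine, π.homogeneous w w' h]
    rfl

/-- The skein presentation of the monochromatic free forest-skein category `𝓤𝓕⟨x⟩`: one colour, no
relation. -/
def mono : SkeinPresentation Unit where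
  rel _ _ := False
  numbered _ _ h := h.elim

/-! ### The Ore property of the versions `F`, `T`, `BV` follows from the one of `V` -/

section Versions

variable {S : Type u} (P : SkeinPresentation S)

theorem toPerm_posLift' {m : ℕ} (π : Equiv.Perm (Fin m)) : toPerm (posLift π) = π⁻¹ := by
  rw [← inv_inv (toPerm _), toPerm_posLift]

/-- Common multiples in `𝓕^V` can be chosen with a given permutation on top. -/
theorem exists_normalized (h : IsOreCategory (FSCat P .V)) {n m m' : ℕ} (f : VHom P n m)
    (g : VHom P n m') : ∃ (k : ℕ) (p : VHom P m k) (q : VHom P m' k),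
      f.comp p = g.comp q ∧ (f.comp p).leaves = List.finRange k := by
  obtain ⟨k, p, q, hpq⟩ : ∃ (k : ℕ) (p : VHom P m k) (q : VHom P m' k),
      f.comp p = g.comp q := by
    obtain ⟨⟨k⟩, p, q, hpq⟩ :=
      h.common_multiple (x := ⟨n⟩) (y := ⟨m⟩) (z := ⟨m'⟩) f g
    exact ⟨k, p, q, hpq⟩
  refine ⟨k, p.comp (VHom.ofPerm (f.comp p).ord⁻¹), q.comp (VHom.ofPerm (f.comp p).ord⁻¹), ?_, ?_⟩
  · rw [← VHom.comp_assoc, ← VHom.comp_assoc, hpq]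
  · rw [← VHom.comp_assoc, VHom.leaves_comp, ← VHom.map_ord (f.comp p)]
    have : (VHom.ofPerm (f.comp p).ord⁻¹ : VHom P k k).treeLeaves =
      fun i => [(f.comp p).ord⁻¹ i] := rfl
    rw [this, ← List.map_eq_flatMap, List.map_map, ← Equiv.Perm.coe_mul, inv_mul_cancel]
    exact List.map_id _

theorem isOre_of_V (h : IsOreCategory (FSCat P .V)) (X : ThompsonType) :
    IsOreCategory (FSCat P X) := by
  have cancel : ∀ {n m k : ℕ} (f : VHom P n m) (g g' : VHom P m k),
      f.comp g = f.comp g' → g = g' := fun {n m k} f g g' e =>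
    h.left_cancel (x := ⟨n⟩) (y := ⟨m⟩) (z := ⟨k⟩) f g g' e
  cases X with
  | V => exact h
  | F =>
    refine ⟨fun f g g' e => Subtype.ext (cancel f.1 g.1 g'.1 (congrArg Subtype.val e)), ?_⟩
    rintro ⟨n⟩ ⟨m⟩ ⟨m'⟩ f g
    obtain ⟨k, p, q, e, hl⟩ := exists_normalized P h f.1 g.1
    have hp := hl
    have hq := e ▸ hl
    rw [VHom.leaves_comp, f.2, ← VHom.leaves_eq_flatMap] at hp
    rw [VHom.leaves_comp, g.2, ← VHom.leaves_eq_flatMap] at hq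
    exact ⟨⟨k⟩, ⟨p, hp⟩, ⟨q, hq⟩, Subtype.ext e⟩
  | T =>
    refine ⟨fun f g g' e => Subtype.ext (cancel f.1 g.1 g'.1 (congrArg Subtype.val e)), ?_⟩
    rintro ⟨n⟩ ⟨m⟩ ⟨m'⟩ f g
    obtain ⟨k, p, q, e, hl⟩ := exists_normalized P h f.1 g.1
    have hp := FSHom.isRotated_flatMap f.2 p.treeLeaves
    have hq := FSHom.isRotated_flatMap g.2 q.treeLeaves
    rw [← VHom.leaves_comp, ← VHom.leaves_eq_flatMap] at hp hq
    rw [hl] at hp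
    rw [← e, hl] at hq
    exact ⟨⟨k⟩, ⟨p, hp.symm⟩, ⟨q, hq.symm⟩, Subtype.ext e⟩
  | BV =>
    constructor
    · intro x y z f g g' e
      have e1 : f.1.1.comp g.1.1 = f.1.1.comp g'.1.1 := congrArg (fun a => a.1.1) e
      have e2 := cancel _ _ _ e1
      have e3 : cable g.1.1 f.1.2 1 * g.1.2 = cable g'.1.1 f.1.2 1 * g'.1.2 :=
        congrArg (fun a => a.1.2) e
      rw [e2] at e3
      exact Subtype.ext (Prod.ext e2 (mul_left_cancel e3))
    · rintro ⟨n⟩ ⟨m⟩ ⟨m'⟩ f g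
      obtain ⟨k, p, q, e, -⟩ := exists_normalized P h f.1.1 g.1.1
      refine ⟨⟨k⟩, ⟨(p, posLift p.ord), toPerm_posLift _⟩,
        ⟨(q, (cable q g.1.2 1)⁻¹ * (cable p f.1.2 1 * posLift p.ord)), ?_⟩, ?_⟩
      · have h1 := toPerm_cable p f.1.2 1
        have h2 := toPerm_cable q g.1.2 1
        rw [f.2, one_mul, blockOrd_one] at h1
        rw [g.2, one_mul, blockOrd_one] at h2
        have h3 : blockOrd p f.1.1.ord = blockOrd q g.1.1.ord := by
          rw [blockOrd, blockOrd, ← VHom.ord_comp, ← VHom.ord_comp, e]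
        simp only [map_mul, mul_inv_rev, map_inv, inv_inv, toPerm_posLift']
        rw [h1, ← inv_inv (toPerm (cable q _ _)), h2, h3]
        group
      · refine Subtype.ext (Prod.ext e ?_)
        change cable p f.1.2 1 * posLift p.ord =
          cable q g.1.2 1 * ((cable q g.1.2 1)⁻¹ * (cable p f.1.2 1 * posLift p.ord))
        rw [mul_inv_cancel_left]

end Versions


/-! ### The monochromatic forest-skein category is an Ore category -/

section Mono

/-- The complete binary tree of height `N`, with leaves labelled through their addresses. -/
def fullTree {β : Type} : (N : ℕ) → ((Fin N → Bool) → β) → CTree Unit β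
  | 0, e => .leaf (e Fin.elim0)
  | N + 1, e => .node () (fullTree N fun a => e (Fin.cons false a))
      (fullTree N fun a => e (Fin.cons true a))

theorem mem_fullTree {β : Type} (N : ℕ) (e : (Fin N → Bool) → β) (x : β) :
    x ∈ (fullTree N e).leaves ↔ ∃ a, e a = x := by
  induction N with
  | zero =>
    simp only [fullTree, CTree.leaves, List.mem_singleton]
    constructor
    · rintro rfl; exact ⟨_, rfl⟩
    · rintro ⟨a, rfl⟩; rw [Subsingleton.elim a Fin.elim0]
  | succ N ih =>
    simp only [fullTree, CTree.leaves, List.mem_append, ih]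
    constructor
    · rintro (⟨a, rfl⟩ | ⟨a, rfl⟩) <;> exact ⟨_, rfl⟩
    · rintro ⟨a, rfl⟩
      rw [← Fin.cons_self_tail a]
      cases a 0
      · exact Or.inl ⟨_, rfl⟩
      · exact Or.inr ⟨_, rfl⟩

theorem nodup_fullTree {β : Type} (N : ℕ) (e : (Fin N → Bool) → β) (he : Function.Injective e) :
    (fullTree N e).leaves.Nodup := by
  induction N with
  | zero => simp [fullTree, CTree.leaves]
  | succ N ih =>
    simp only [fullTree, CTree.leaves]
    refine List.Nodup.append (ih _ fun a b h => ?_) (ih _ fun a b h => ?_) fun x h1 h2 => ?_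
    · exact (Fin.cons_injective2 (he h)).2
    · exact (Fin.cons_injective2 (he h)).2
    · obtain ⟨a, rfl⟩ := (mem_fullTree _ _ _).1 h1
      obtain ⟨b, hb⟩ := (mem_fullTree _ _ _).1 h2
      exact absurd (Fin.cons_injective2 (he hb)).1 (by decide)

def CTree.height {S : Type u} {α : Type} : CTree S α → ℕ
  | .leaf _ => 0
  | .node _ l r => max l.height r.height + 1

theorem CTree.bind_congr {S : Type u} {α β : Type} (t : CTree S α) {g g' : α → CTree S β}
    (h : ∀ x ∈ t.leaves, g x = g' x) : t.bind g = t.bind g' := by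
  induction t with
  | leaf x => exact h x (by simp [CTree.leaves])
  | node c l r hl hr =>
    simp only [CTree.bind]
    rw [hl fun x hx => h x (by simp [CTree.leaves, hx]),
      hr fun x hx => h x (by simp [CTree.leaves, hx])]

theorem CTree.eq_of_bind_eq {S : Type u} {α β : Type} (t : CTree S α) {g g' : α → CTree S β}
    (h : t.bind g = t.bind g') : ∀ x ∈ t.leaves, g x = g' x := by
  induction t with
  | leaf x =>
    intro y hy
    rw [CTree.leaves, List.mem_singleton] at hy
    subst hy
    exact h
  | node c l r hl hr =>
    simp only [CTree.bind, CTree.node.injEq] at h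
    intro x hx
    rcases List.mem_append.1 hx with hx | hx
    · exact hl h.2.1 x hx
    · exact hr h.2.2 x hx

theorem exists_bind_fullTree {α β : Type} (t : CTree Unit α) (ht : t.leaves.Nodup) (N : ℕ)
    (hN : t.height ≤ N) (e : (Fin N → Bool) → β) :
    ∃ u : α → CTree Unit β, t.bind u = fullTree N e := by
  classical
  induction t generalizing N with
  | leaf x => exact ⟨fun _ => fullTree N e, rfl⟩
  | node c l r hl hr =>
    obtain _ | N := N
    · simp [CTree.height] at hN
    simp only [CTree.height] at hN
    simp only [CTree.leaves] at ht
    obtain ⟨u, hu⟩ := hl ht.of_append_left N (by omega) fun a => e (Fin.cons false a)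
    obtain ⟨v, hv⟩ := hr ht.of_append_right N (by omega) fun a => e (Fin.cons true a)
    refine ⟨fun x => if x ∈ l.leaves then u x else v x, ?_⟩
    simp only [CTree.bind, fullTree]
    rw [← hu, ← hv]
    congr 1
    · exact l.bind_congr fun x hx => if_pos hx
    · exact r.bind_congr fun x hx => if_neg fun hx' => List.disjoint_of_nodup_append ht hx' hx

theorem mono_treeEquiv {α : Type} {t s : CTree Unit α} (h : mono.TreeEquiv t s) : t = s := by
  induction h with
  | rel t s h =>
    induction h with
    | base h g => exact h.elim
    | left c r h ih => rw [ih]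
    | right c l h ih => rw [ih]
  | refl => rfl
  | symm _ _ _ ih => exact ih.symm
  | trans _ _ _ _ _ h1 h2 => exact h1.trans h2

theorem VForest.nodup_leaves {S : Type u} {n m : ℕ} (f : VForest S n m) : f.leaves.Nodup :=
  f.perm.nodup_iff.2 (List.nodup_finRange m)

theorem VForest.exists_mem {S : Type u} {n m : ℕ} (f : VForest S n m) (j : Fin m) :
    ∃ i, j ∈ (f.tree i).leaves := by
  have h : j ∈ f.leaves := f.perm.mem_iff.2 (List.mem_finRange j)
  obtain ⟨i, -, hi⟩ := List.mem_flatMap.1 h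
  exact ⟨i, hi⟩

theorem VForest.unique_mem {S : Type u} {n m : ℕ} (f : VForest S n m) {j : Fin m} {i i' : Fin n}
    (h : j ∈ (f.tree i).leaves) (h' : j ∈ (f.tree i').leaves) : i = i' := by
  have hd := (pairwise_finRange _).1 (List.nodup_flatMap.1 f.nodup_leaves).2
  rcases lt_trichotomy i i' with hlt | heq | hgt
  · exact (hd _ _ hlt h h').elim
  · exact heq
  · exact (hd _ _ hgt h' h).elim

theorem VForest.nodup_tree {S : Type u} {n m : ℕ} (f : VForest S n m) (i : Fin n) :
    (f.tree i).leaves.Nodup := (List.nodup_flatMap.1 f.nodup_leaves).1 i (List.mem_finRange i)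

theorem VForest.exists_full {n m : ℕ} (f : VForest Unit n m) (N : ℕ)
    (hN : ∀ i, (f.tree i).height ≤ N) {k : ℕ} (e : Fin n × (Fin N → Bool) ≃ Fin k) :
    ∃ g : VForest Unit m k, ∀ i, (f.tree i).bind g.tree = fullTree N fun a => e (i, a) := by
  choose u hu using fun i =>
    exists_bind_fullTree (f.tree i) (f.nodup_tree i) N (hN i) fun a => e (i, a)
  choose o ho using f.exists_mem
  have key : ∀ i, ((f.tree i).bind fun j => u (o j) j) = fullTree N fun a => e (i, a) := by
    intro i
    rw [← hu i]
    refine CTree.bind_congr _ fun j hj => ?_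
    rw [f.unique_mem (ho j) hj]
  refine ⟨⟨fun j => u (o j) j, ?_⟩, key⟩
  refine ((f.perm.flatMap_right _).symm.trans (List.Perm.of_eq ?_)).trans
    ((List.perm_ext_iff_of_nodup (l₁ := (List.finRange n).flatMap
      fun i => (fullTree N fun a => e (i, a)).leaves) ?_ (List.nodup_finRange k)).2 ?_)
  · rw [List.flatMap_assoc]
    simp only [← CTree.leaves_bind, key]
  · refine List.nodup_flatMap.2 ⟨fun i _ => nodup_fullTree _ _ fun a b h => ?_, ?_⟩
    · exact congrArg Prod.snd (e.injective h)
    · refine (List.nodup_finRange n).imp fun {i j} hij => ?_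
      intro x hx hx'
      obtain ⟨a, rfl⟩ := (mem_fullTree _ _ _).1 hx
      obtain ⟨b, hb⟩ := (mem_fullTree _ _ _).1 hx'
      exact hij (congrArg Prod.fst (e.injective hb)).symm
  · intro x
    simp only [List.mem_finRange, iff_true, List.mem_flatMap, true_and, mem_fullTree]
    exact ⟨(e.symm x).1, (e.symm x).2, by simp⟩

theorem mono_isOre_V : IsOreCategory (FSCat mono .V) := by
  constructor
  · rintro ⟨n⟩ ⟨m⟩ ⟨k⟩ f g g' e
    change VHom mono n m at f
    change VHom mono m k at g g'
    change f.comp g = f.comp g' at e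
    change g = g'
    induction f using VHom.ind with
    | h f => induction g using VHom.ind with
    | h g => induction g' using VHom.ind with
    | h g' =>
      refine Quotient.sound (s := forestSetoid mono m k) fun j => ?_
      obtain ⟨i, hi⟩ := f.exists_mem j
      have := mono_treeEquiv (Quotient.exact (s := forestSetoid mono n k) e i)
      rw [CTree.eq_of_bind_eq _ this j hi]
      exact .refl _
  · rintro ⟨n⟩ ⟨m⟩ ⟨m'⟩ f g
    change VHom mono n m at f
    change VHom mono n m' at g
    induction f using VHom.ind with
    | h f => induction g using VHom.ind with
    | h g =>
      let N := ∑ i, ((f.tree i).height + (g.tree i).height)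
      have hN : ∀ i, (f.tree i).height + (g.tree i).height ≤ N := fun i =>
        Finset.single_le_sum (f := fun i => (f.tree i).height + (g.tree i).height)
          (fun _ _ => Nat.zero_le _) (Finset.mem_univ i)
      let e := Fintype.equivFin (Fin n × (Fin N → Bool))
      obtain ⟨u, hu⟩ := f.exists_full N (fun i => by have := hN i; omega) e
      obtain ⟨v, hv⟩ := g.exists_full N (fun i => by have := hN i; omega) e
      refine ⟨⟨_⟩, VHom.mk u, VHom.mk v, ?_⟩
      refine Quotient.sound (s := forestSetoid mono n _) fun i => ?_
      change mono.TreeEquiv ((f.tree i).bind u.tree) ((g.tree i).bind v.tree)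
      rw [hu, hv]
      exact .refl _

instance (X : ThompsonType) : IsOreCategory (FSCat mono X) := isOre_of_V mono mono_isOre_V X

end Mono

/-! ### The Thompson groups and their action on the dyadic rationals -/

/-- The Thompson group `X ∈ {F, T, V, BV}`: classes of pairs of trees with the same number of leaves,
together with a (trivial, cyclic, arbitrary, braided) bijection between their leaves. -/
abbrev Thompson (X : ThompsonType) : Type := FSGroup mono X

/-- The dyadic rationals in `[0, 1)`. -/
def Q2 : Type := {q : ℚ // 0 ≤ q ∧ q < 1 ∧ ∃ (n : ℕ) (k : ℤ), q * 2 ^ n = k}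

namespace Q2

/-- The affine bijections from `[0, 1)` to `[0, 1/2)` and `[1/2, 1)`. -/
def half (b : Bool) (q : Q2) : Q2 := ⟨(q.1 + if b then 1 else 0) / 2, by
  obtain ⟨q, h0, h1, n, k, h⟩ := q
  refine ⟨?_, ?_, n + 1, k + if b then 2 ^ n else 0, ?_⟩
  · cases b <;> simp <;> linarith
  · cases b <;> simp <;> linarith
  · cases b <;> simp [pow_succ] <;> linarith⟩

/-- The doubling map. -/
def double (q : Q2) : Q2 := ⟨if q.1 < 1 / 2 then 2 * q.1 else 2 * q.1 - 1, by
  obtain ⟨q, h0, h1, n, k, h⟩ := q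
  refine ⟨?_, ?_, n, if q < 1 / 2 then 2 * k else 2 * k - 2 ^ n, ?_⟩
  · dsimp only; split_ifs <;> linarith
  · dsimp only; split_ifs <;> linarith
  · dsimp only; split_ifs <;> push_cast <;> linarith⟩

theorem double_half (b : Bool) (q : Q2) : double (half b q) = q := by
  apply Subtype.ext
  obtain ⟨q, h0, h1, -⟩ := q
  cases b
  · simp only [double, half, Bool.false_eq_true, if_false]
    rw [if_pos (by linarith)]; ring
  · simp only [double, half, if_true]
    rw [if_neg (by linarith)]; ring

theorem half_lt (b : Bool) (q : Q2) : (half b q).1 < 1 / 2 ↔ b = false := by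
  obtain ⟨q, h0, h1, -⟩ := q
  cases b
  · simp only [half, Bool.false_eq_true, if_false, iff_true]; linarith
  · simp only [half, if_true, Bool.true_eq_false, iff_false, not_lt]; linarith

theorem eq_of_double {q q' : Q2} (h : (q.1 < 1 / 2) ↔ (q'.1 < 1 / 2)) (e : double q = double q') :
    q = q' := by
  have e' := congrArg Subtype.val e
  simp only [double] at e'
  apply Subtype.ext
  by_cases h1 : q.1 < 1 / 2
  · rw [if_pos h1, if_pos (h.1 h1)] at e'; linarith
  · rw [if_neg h1, if_neg (fun h2 => h1 (h.2 h2))] at e'; linarith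

end Q2

namespace CTree

variable {S : Type u} {α β : Type}

/-- Every leaf of a tree corresponds to a standard dyadic interval: the interval of the root
is `[0, 1)`, and the left and right children of a vertex correspond to the two halves of its interval.
This returns the label of the leaf whose interval `[c, c + 2⁻ᵈ)` contains `q`, together with
the rescaled point `2ᵈ (q - c)`. -/
def walk : CTree S α → Q2 → α × Q2
  | leaf x, q => (x, q)
  | node _ l r, q => if q.1 < 1 / 2 then l.walk q.double else r.walk q.double

/-- The distance `d` from the root to the leaf whose standard dyadic interval contains `q`. -/
def depth : CTree S α → Q2 → ℕ
  | leaf _, _ => 0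
  | node _ l r, q => (if q.1 < 1 / 2 then l.depth q.double else r.depth q.double) + 1

theorem walk_bind (t : CTree S α) (g : α → CTree S β) (q : Q2) :
    (t.bind g).walk q = (g (t.walk q).1).walk (t.walk q).2 := by
  induction t generalizing q with
  | leaf x => rfl
  | node c l r hl hr => simp only [bind, walk]; split_ifs <;> simp [hl, hr]

theorem depth_bind (t : CTree S α) (g : α → CTree S β) (q : Q2) :
    (t.bind g).depth q = t.depth q + (g (t.walk q).1).depth (t.walk q).2 := by
  induction t generalizing q with
  | leaf x => simp [bind, walk, depth]
  | node c l r hl hr => simp only [bind, walk, depth]; split_ifs <;> simp [hl, hr] <;> ring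

theorem walk_mem (t : CTree S α) (q : Q2) : (t.walk q).1 ∈ t.leaves := by
  induction t generalizing q with
  | leaf x => simp [walk, leaves]
  | node c l r hl hr => simp only [walk, leaves]; split_ifs <;> simp [hl, hr]

theorem exists_walk (t : CTree S α) {x : α} (hx : x ∈ t.leaves) (q : Q2) :
    ∃ q', t.walk q' = (x, q) := by
  induction t with
  | leaf y => exact ⟨q, by simp [leaves] at hx; simp [walk, hx]⟩
  | node c l r hl hr =>
    rcases List.mem_append.1 hx with hx | hx
    · obtain ⟨q', h⟩ := hl hx
      exact ⟨q'.half false, by rw [walk, if_pos ((Q2.half_lt _ _).2 rfl), Q2.double_half, h]⟩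
    · obtain ⟨q', h⟩ := hr hx
      exact ⟨q'.half true, by
        rw [walk, if_neg (fun h => by have := (Q2.half_lt _ _).1 h; simp at this), Q2.double_half, h]⟩

theorem walk_injective (t : CTree S α) (ht : t.leaves.Nodup) : Function.Injective t.walk := by
  induction t with
  | leaf x => intro q q' h; exact congrArg Prod.snd h
  | node c l r hl hr =>
    simp only [leaves] at ht
    have hd := List.disjoint_of_nodup_append ht
    intro q q' h
    simp only [walk] at h
    split_ifs at h with h1 h2 h2
    · exact Q2.eq_of_double (by tauto) (hl ht.of_append_left h)
    · exact (hd (l.walk_mem q.double) (h ▸ r.walk_mem q'.double)).elim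
    · exact (hd (l.walk_mem q'.double) (h ▸ r.walk_mem q.double)).elim
    · exact Q2.eq_of_double (by tauto) (hr ht.of_append_right h)

theorem walk_bound (t : CTree S α) (q : Q2) : 1 ≤ (t.walk q).2.1 + 2 ^ t.depth q * (1 - q.1) := by
  induction t generalizing q with
  | leaf x => simp [walk, depth]
  | node c l r hl hr =>
    simp only [walk, depth]
    split_ifs with h
    · have := hl q.double
      have e : q.double.1 = 2 * q.1 := by simp only [Q2.double, if_pos h]
      have hp : (0 : ℚ) < 2 ^ l.depth q.double := by positivity
      rw [e] at this
      rw [pow_succ]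
      linarith
    · have := hr q.double
      have e : q.double.1 = 2 * q.1 - 1 := by simp only [Q2.double, if_neg h]
      rw [e] at this
      rw [pow_succ]
      linarith

/-- Near a point and on its right, `walk` is affine with slope `2 ^ depth`. -/
theorem walk_right (t : CTree S α) (q y : Q2) (h : q.1 ≤ y.1)
    (h' : (t.walk q).2.1 + 2 ^ t.depth q * (y.1 - q.1) < 1) :
    (t.walk y).1 = (t.walk q).1 ∧ (t.walk y).2.1 = (t.walk q).2.1 + 2 ^ t.depth q * (y.1 - q.1) := by
  induction t generalizing q y with
  | leaf x => exact ⟨rfl, by simp [walk, depth]⟩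
  | node c l r hl hr =>
    simp only [walk, depth] at h' ⊢
    by_cases hq : q.1 < 1 / 2
    · rw [if_pos hq, if_pos hq] at h'
      have hy : y.1 < 1 / 2 := by
        have hb := l.walk_bound q.double
        have e : q.double.1 = 2 * q.1 := by simp only [Q2.double, if_pos hq]
        rw [e] at hb
        rw [pow_succ] at h'
        have hp : (0 : ℚ) < 2 ^ l.depth q.double := by positivity
        by_contra hc
        have : (2 : ℚ) ^ l.depth q.double * (1 / 2) ≤ 2 ^ l.depth q.double * y.1 :=
          mul_le_mul_of_nonneg_left (not_lt.1 hc) hp.le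
        linarith
      have e : y.double.1 - q.double.1 = 2 * (y.1 - q.1) := by
        simp only [Q2.double, if_pos hq, if_pos hy]; ring
      rw [if_pos hq, if_pos hq, if_pos hy]
      have := hl q.double y.double (by linarith) (by rw [e]; rw [pow_succ] at h'; linarith)
      rw [e] at this
      refine ⟨this.1, this.2.trans ?_⟩
      rw [pow_succ]; ring
    · have hy : ¬ y.1 < 1 / 2 := fun hy => hq (h.trans_lt hy)
      rw [if_neg hq, if_neg hq] at h'
      have e : y.double.1 - q.double.1 = 2 * (y.1 - q.1) := by
        simp only [Q2.double, if_neg hq, if_neg hy]; ring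
      rw [if_neg hq, if_neg hq, if_neg hy]
      have := hr q.double y.double (by linarith) (by rw [e]; rw [pow_succ] at h'; linarith)
      rw [e] at this
      refine ⟨this.1, this.2.trans ?_⟩
      rw [pow_succ]; ring

end CTree

/-- The bijection `{roots} × [0, 1) → {leaves} × [0, 1)` (on dyadic rationals) defined by a forest:
the standard dyadic interval of a leaf is sent to the copy of `[0, 1)` indexed by this leaf. -/
def VForest.walk {S : Type u} {n m : ℕ} (f : VForest S n m) (a : Fin n × Q2) : Fin m × Q2 :=
  (f.tree a.1).walk a.2

theorem VForest.walk_bijective {S : Type u} {n m : ℕ} (f : VForest S n m) :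
    Function.Bijective f.walk := by
  constructor
  · rintro ⟨i, q⟩ ⟨i', q'⟩ h
    have h' : (f.tree i).walk q = (f.tree i').walk q' := h
    have hi : i = i' := by
      refine f.unique_mem ((f.tree i).walk_mem q) ?_
      rw [h']
      exact (f.tree i').walk_mem q'
    subst hi
    rw [(f.tree i).walk_injective (f.nodup_tree i) h']
  · rintro ⟨j, q⟩
    obtain ⟨i, hi⟩ := f.exists_mem j
    obtain ⟨q', hq'⟩ := (f.tree i).exists_walk hi q
    exact ⟨(i, q'), hq'⟩

namespace VHom

variable {n m k : ℕ}

/-- The bijection `{roots} × [0, 1) → {leaves} × [0, 1)` for a monochromatic forest. -/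
noncomputable def walk (f : VHom mono n m) : Fin n × Q2 ≃ Fin m × Q2 :=
  Equiv.ofBijective (Quotient.lift VForest.walk (fun f g h => by
    funext a
    exact congrArg (fun t => t.walk a.2) (mono_treeEquiv (h a.1))) f) (by
    induction f using ind with
    | h f => exact f.walk_bijective)

/-- The distance to the root of the leaf whose standard dyadic interval contains a given point. -/
def depth : VHom mono n m → Fin n × Q2 → ℕ :=
  Quotient.lift (fun f a => (f.tree a.1).depth a.2) (fun f g h => by
    funext a
    exact congrArg (fun t => t.depth a.2) (mono_treeEquiv (h a.1)))

theorem walk_comp (f : VHom mono n m) (g : VHom mono m k) (a : Fin n × Q2) :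
    (f.comp g).walk a = g.walk (f.walk a) := by
  induction f using ind with
  | h f => induction g using ind with
  | h g => exact CTree.walk_bind _ _ _

theorem depth_comp (f : VHom mono n m) (g : VHom mono m k) (a : Fin n × Q2) :
    (f.comp g).depth a = f.depth a + g.depth (f.walk a) := by
  induction f using ind with
  | h f => induction g using ind with
  | h g => exact CTree.depth_bind _ _ _

end VHom

/-- The action of `[f, g] ∈ V` on the dyadic rationals: the standard dyadic interval of the `j`-th
leaf of `g` is sent affinely onto the one of the corresponding leaf of `f`. -/
noncomputable def actPerm : Thompson .V →* Equiv.Perm (Fin 1 × Q2) where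
  toFun := Quot.lift
    (fun P => (VHom.walk P.den).trans (VHom.walk (n := 1) (m := P.tgt.n) P.num).symm) (by
      rintro P _ ⟨z, r, rfl⟩
      ext1 a
      apply (VHom.walk (n := 1) (m := z.n) (P.num ≫ r)).injective
      simp only [Equiv.trans_apply, Equiv.apply_symm_apply]
      refine (VHom.walk_comp (m := P.tgt.n) P.num r _).trans ?_
      rw [Equiv.apply_symm_apply]
      exact (VHom.walk_comp (m := P.tgt.n) P.den r _).symm)
  map_one' := by
    change (VHom.walk _).trans (VHom.walk _).symm = 1
    exact Equiv.self_trans_symm _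
  map_mul' a b := by
    obtain ⟨y, f, g, h, rfl, rfl⟩ := exists_rep₂ a b
    rw [frac_mul_same]
    change (VHom.walk h).trans (VHom.walk f).symm =
      ((VHom.walk g).trans (VHom.walk f).symm) * ((VHom.walk h).trans (VHom.walk g).symm)
    ext1 a
    simp [Equiv.Perm.mul_apply]

noncomputable def actPermQ2 : Thompson .V →* Equiv.Perm Q2 :=
  (Equiv.uniqueProd Q2 (Fin 1)).permCongrHom.toMonoidHom.comp actPerm

/-- The integer `log₂ v'(q)`, for `v = [f, g] ∈ V` and `q ∈ Q2`, where `v'` is the right-derivative: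
`v` sends the standard dyadic interval of length `2 ^ (-d)` containing `q` affinely onto the one of
length `2 ^ (-e)` containing `v q`, where `d` and `e` are the distances to the root of the
corresponding leaves of `g` and `f`, so that `v'(q) = 2 ^ (d - e)`. -/
noncomputable def logSlopeV (v : Thompson .V) (q : Q2) : ℤ :=
  Quot.lift (fun P : FracPair (C := FSCat mono .V) ⟨1⟩ =>
    ((VHom.depth (m := P.tgt.n) P.den (0, q) : ℕ) : ℤ) -
      (VHom.depth (n := 1) (m := P.tgt.n) P.num (actPerm (frac P.num P.den) (0, q)) : ℕ)) (by
    rintro P _ ⟨z, r, rfl⟩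
    simp only [frac_comp]
    have h1 := VHom.depth_comp (n := 1) (m := P.tgt.n) (k := z.n) P.den r (0, q)
    have h2 := VHom.depth_comp (n := 1) (m := P.tgt.n) (k := z.n) P.num r
      (actPerm (frac P.num P.den) (0, q))
    have h3 : VHom.walk (n := 1) (m := P.tgt.n) P.num (actPerm (frac P.num P.den) (0, q)) =
      VHom.walk (n := 1) (m := P.tgt.n) P.den (0, q) := Equiv.apply_symm_apply _ _
    rw [h3] at h2
    change _ = ((VHom.depth (VHom.comp _ _) _ : ℕ) : ℤ) - (VHom.depth (VHom.comp _ _) _ : ℕ)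
    rw [h1, h2]
    push_cast
    ring) v

/-- The morphism `X → V`: the inclusion for `F`, `T`, `V` and the canonical quotient map for `BV`. -/
noncomputable def Thompson.toV (X : ThompsonType) : Thompson X →* Thompson .V :=
  match X with
  | .F => fracMap (ForestSkein.toV mono .F) ⟨1⟩
  | .T => fracMap (ForestSkein.toV mono .T) ⟨1⟩
  | .V => MonoidHom.id _
  | .BV => fracMap (ForestSkein.toV mono .BV) ⟨1⟩

/-- The action of the Thompson group `X` on the dyadic rationals. -/
noncomputable instance (X : ThompsonType) : MulAction (Thompson X) Q2 :=
  MulAction.compHom Q2 (actPermQ2.comp (Thompson.toV X))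

/-- The integer `log₂ v'(q)` for `v ∈ X`. -/
noncomputable def logSlope {X : ThompsonType} (v : Thompson X) (q : Q2) : ℤ :=
  logSlopeV (Thompson.toV X v) q


/-! ### The chain rule for right-derivatives -/

theorem Thompson.smul_def {X : ThompsonType} (v : Thompson X) (q : Q2) :
    v • q = actPermQ2 (Thompson.toV X v) q := rfl

theorem actPermQ2_frac {n : FSCat mono .V} (f g : (⟨1⟩ : FSCat mono .V) ⟶ n) (q : Q2) :
    VHom.walk (n := 1) (m := n.n) f (0, actPermQ2 (frac f g) q) =
      VHom.walk (n := 1) (m := n.n) g (0, q) := by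
  have h : ((0, actPermQ2 (frac f g) q) : Fin 1 × Q2) = actPerm (frac f g) (0, q) :=
    Prod.ext (Subsingleton.elim _ _) rfl
  rw [h]
  exact Equiv.apply_symm_apply _ _

theorem logSlopeV_frac {n : FSCat mono .V} (f g : (⟨1⟩ : FSCat mono .V) ⟶ n) (q : Q2) :
    logSlopeV (frac f g) q = ((VHom.depth (m := n.n) g (0, q) : ℕ) : ℤ) -
      (VHom.depth (n := 1) (m := n.n) f (0, actPermQ2 (frac f g) q) : ℕ) := by
  have h : ((0, actPermQ2 (frac f g) q) : Fin 1 × Q2) = actPerm (frac f g) (0, q) :=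
    Prod.ext (Subsingleton.elim _ _) rfl
  rw [h]
  rfl

theorem logSlopeV_mul (v w : Thompson .V) (q : Q2) :
    logSlopeV (v * w) q = logSlopeV v (actPermQ2 w q) + logSlopeV w q := by
  obtain ⟨y, f, g, h, rfl, rfl⟩ := exists_rep₂ v w
  have e : actPermQ2 (frac f g) (actPermQ2 (frac g h) q) = actPermQ2 (frac f h) q := by
    rw [← frac_mul_same f g h, map_mul, Equiv.Perm.mul_apply]
  rw [frac_mul_same, logSlopeV_frac, logSlopeV_frac, logSlopeV_frac, e]
  ring

theorem logSlope_mul {X : ThompsonType} (v w : Thompson X) (q : Q2) :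
    logSlope (v * w) q = logSlope v (w • q) + logSlope w q := by
  rw [logSlope, map_mul, logSlopeV_mul]
  rfl

/-- `v` is affine with slope `2 ^ logSlope v q` on the right of `q`: the integer `logSlope v q` is
indeed the base-2 logarithm of the right-derivative of `v` at `q`. -/
theorem logSlope_spec {X : ThompsonType} (v : Thompson X) (q : Q2) :
    ∃ ε : ℚ, 0 < ε ∧ ∀ y : Q2, q.1 ≤ y.1 → y.1 < q.1 + ε →
      (v • y).1 = (v • q).1 + 2 ^ logSlope v q * (y.1 - q.1) := by
  simp only [Thompson.smul_def, logSlope]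
  generalize Thompson.toV X v = v
  obtain ⟨n, f, g, rfl⟩ := v.exists_rep
  rw [logSlopeV_frac]
  have key := actPermQ2_frac f g
  generalize hF : (fun y => actPermQ2 (frac f g) y) = F at *
  have hF' : ∀ y, actPermQ2 (frac f g) y = F y := fun y => congrFun hF y
  have hinj : Function.Injective F := by rw [← hF]; exact (actPermQ2 (frac f g)).injective
  have hsurj : Function.Surjective F := by rw [← hF]; exact (actPermQ2 (frac f g)).surjective
  simp only [hF'] at key ⊢
  clear hF hF'
  obtain ⟨n⟩ := n
  change VHom mono 1 n at f g
  induction f using VHom.ind with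
  | h f => induction g using VHom.ind with
  | h g =>
    change ∀ y, (f.tree 0).walk (F y) = (g.tree 0).walk y at key
    change ∃ ε : ℚ, 0 < ε ∧ ∀ y : Q2, q.1 ≤ y.1 → y.1 < q.1 + ε →
      (F y).1 = (F q).1 + 2 ^ (((g.tree 0).depth q : ℤ) - ((f.tree 0).depth (F q) : ℕ)) *
        (y.1 - q.1)
    have hs := (f.tree 0).walk_injective (f.nodup_tree 0)
    generalize f.tree 0 = s at *
    generalize g.tree 0 = t at *
    have h1 : (t.walk q).2.1 < 1 := (t.walk q).2.2.2.1
    have hp : (0 : ℚ) < 2 ^ t.depth q := by positivity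
    refine ⟨(1 - (t.walk q).2.1) / 2 ^ t.depth q, div_pos (by linarith) hp, fun y hy hy' => ?_⟩
    have hy2 : (t.walk q).2.1 + 2 ^ t.depth q * (y.1 - q.1) < 1 := by
      have : (y.1 - q.1) * 2 ^ t.depth q < 1 - (t.walk q).2.1 := (lt_div_iff₀ hp).1 (by linarith)
      linarith
    obtain ⟨ht1, ht2⟩ := t.walk_right q y hy hy2
    have hb := s.walk_bound (F q)
    rw [key q] at hb
    have hpe : (0 : ℚ) < 2 ^ s.depth (F q) := by positivity
    rw [zpow_sub₀ (by norm_num), zpow_natCast, zpow_natCast]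
    generalize hz : (F q).1 + 2 ^ t.depth q / 2 ^ s.depth (F q) * (y.1 - q.1) = z
    have hz' : 2 ^ s.depth (F q) * (z - (F q).1) = 2 ^ t.depth q * (y.1 - q.1) := by
      rw [← hz]; field_simp; ring
    have hz0 : (F q).1 ≤ z := by
      rw [← hz]
      have : 0 ≤ 2 ^ t.depth q / 2 ^ s.depth (F q) * (y.1 - q.1) :=
        mul_nonneg (by positivity) (by linarith)
      linarith
    have hz1 : z < 1 := by
      by_contra hc
      have : (2 : ℚ) ^ s.depth (F q) * 1 ≤ 2 ^ s.depth (F q) * z :=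
        mul_le_mul_of_nonneg_left (not_lt.1 hc) hpe.le
      linarith
    have hz2 : ∃ (n : ℕ) (k : ℤ), z * 2 ^ n = k := by
      obtain ⟨-, -, a, k, hk⟩ := (F q).2
      obtain ⟨-, -, b, l, hl⟩ := y.2
      obtain ⟨-, -, c, m, hm⟩ := q.2
      refine ⟨a + b + c + s.depth (F q), k * 2 ^ (b + c + s.depth (F q)) +
        2 ^ t.depth q * (l * 2 ^ (a + c) - m * 2 ^ (a + b)), ?_⟩
      push_cast
      rw [← hz, ← hk, ← hl, ← hm]
      simp only [pow_add]
      field_simp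
    have h2 := s.walk_right (F q) ⟨z, (F q).2.1.trans hz0, hz1, hz2⟩ hz0 (by
      rw [key q]; change _ + _ * (z - _) < 1; rw [hz']; exact hy2)
    rw [key q] at h2
    have h3 : F y = ⟨z, (F q).2.1.trans hz0, hz1, hz2⟩ := by
      apply hs
      rw [key y]
      refine Prod.ext (ht1.trans h2.1.symm) (Subtype.ext (ht2.trans (Eq.symm (h2.2.trans ?_))))
      change _ + _ * (z - _) = _
      rw [hz']
    rw [h3]

/-! ### Twisted permutational restricted wreath products -/

/-- A twist for a group `B` acting on a set `Q` with values in `Aut(A)`: a map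
`τ : B × Q → Aut(A)` with the cocycle identity `τ(bc, q) = τ(b, q) ∘ τ(c, b⁻¹ q)`. -/
structure TwistCocycle (B : Type*) (Q : Type*) (A : Type*) [Group B] [MulAction B Q]
    [Group A] where
  τ : B → Q → MulAut A
  map_mul : ∀ b c q, τ (b * c) q = τ b q * τ c (b⁻¹ • q)

/-- The direct sum `⊕_Q A`: the group of the finitely supported maps `Q → A`. -/
def finSupp (Q : Type*) (A : Type*) [Group A] : Subgroup (Q → A) where
  carrier := {k | (Function.mulSupport k).Finite}
  one_mem' := by simp
  mul_mem' {k l} hk hl := (Set.Finite.union hk hl).subset (Function.mulSupport_mul k l)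
  inv_mem' {k} hk := by simpa using hk

namespace TwistCocycle

variable {B Q A : Type*} [Group B] [MulAction B Q] [Group A] (c : TwistCocycle B Q A)

theorem map_one (q : Q) : c.τ 1 q = 1 := by
  have := c.map_mul 1 1 q
  rwa [mul_one, inv_one, one_smul, eq_comm, mul_eq_left] at this

/-- The formula `(b · k)(q) = τ(b, q)(k(b⁻¹ q))`. -/
def actFun (b : B) (k : finSupp Q A) : finSupp Q A :=
  ⟨fun q => c.τ b q (k.1 (b⁻¹ • q)), by
    refine (Set.Finite.image (fun q => b • q) k.2).subset fun q hq => ?_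
    refine ⟨b⁻¹ • q, fun h => hq ?_, smul_inv_smul b q⟩
    simp only [h, _root_.map_one]⟩

theorem actFun_mul (b b' : B) (k : finSupp Q A) :
    c.actFun (b * b') k = c.actFun b (c.actFun b' k) := by
  apply Subtype.ext
  funext q
  simp [actFun, c.map_mul, mul_smul]

theorem actFun_one (k : finSupp Q A) : c.actFun 1 k = k := by
  apply Subtype.ext
  funext q
  simp [actFun, c.map_one]

/-- The action of `B` on `⊕_Q A` by automorphisms, `(b · k)(q) = τ(b, q)(k(b⁻¹ q))`. -/
def act : B →* MulAut (finSupp Q A) where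
  toFun b :=
    { toFun := c.actFun b
      invFun := c.actFun b⁻¹
      left_inv := fun k => by rw [← actFun_mul, inv_mul_cancel, actFun_one]
      right_inv := fun k => by rw [← actFun_mul, mul_inv_cancel, actFun_one]
      map_mul' := fun k l => by
        apply Subtype.ext
        funext q
        simp [actFun] }
  map_one' := MulEquiv.ext c.actFun_one
  map_mul' b b' := MulEquiv.ext (c.actFun_mul b b')

end TwistCocycle

/-- The twisted permutational restricted wreath product `⊕_Q A ⋊ B`. -/
abbrev TwistedWreath {B Q A : Type*} [Group B] [MulAction B Q] [Group A]
    (c : TwistCocycle B Q A) : Type _ := finSupp Q A ⋊[c.act] B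

/-- The twist of a generator `a`: the automorphism `τ(v, q)` of `K_M` is the conjugation
`k ↦ a ^ (-n) k a ^ n`, where `n = log₂ v'(v⁻¹ q)`. -/
noncomputable def HPPresentation.twist {σ : Type u} (π : HPPresentation σ) [IsOreMonoid π.Mon]
    (a : σ) (X : ThompsonType) : TwistCocycle (Thompson X) Q2 π.K where
  τ v q := MulAut.conjNormal (π.gen a ^ (-logSlope v (v⁻¹ • q)))
  map_mul v w q := by
    rw [← map_mul, ← zpow_add, logSlope_mul, mul_inv_rev, mul_smul, smul_inv_smul, neg_add]

end ForestSkein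

/-! A skein relation only exchanges two left-vines of equal length. The shape of a diagram (its
monochromatic forest, with its permutation or braid) is therefore well defined, and the remaining
information is one element of $M$ for each maximal left-vine. A maximal left-vine ends at one leaf
and corresponds to the left endpoint of that leaf's dyadic interval, so the colours are a function
on dyadic points.

This is encoded by `pathColor`. For a point $q$, multiply along the path from the root to the leaf
containing $q$, reading the true colour at a vertex whose interval starts at $q$ and reading $a$
elsewhere. The result is invariant under the relations (`pathColor_eq_of_treeEquiv`), multiplicative
under stacking (`pathColor_bind`), of length the depth of the leaf, and equal to a power of $a$
unless $q$ is the left endpoint of a leaf. Together with the shape it determines the diagram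
(`VHom.ext_pathColor`), because left-cancellativity of $M$ allows the letters $a$ above a vine to be
removed.

The Ore property follows. Cancellation is checked on shapes and on path colours. For common
multiples, first grow vertices of colour $a$ until the shapes agree. Then grow left-vines at each
leaf, with words given by common multiples in $M$ (`exists_comp_vines_eq`).

For $x=[f,g]$ with shape $v$, the ratio of the path colours of $f$ at $q$ and of $g$ at $v^{-1}q$ is
an untwisted cocycle with values in $\mathrm{Frac}(M)$ (`colorRatio_mul`). Its length is minus
$\log_2 v'(v^{-1}q)$. Multiplying on the right by that power of $a$ brings it into $K_M$, and
commuting this power past later factors produces exactly the twist (`decoration_mul`). The map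
`toWreath` records this decoration and the shape. It is injective because equal shapes and trivial
ratios can be made into equal diagrams by growing the same vines on both sides. It is surjective
because Thompson elements lift by colouring everything with $a$, and a finitely supported function
is realised by vines grown on a tree whose leaves start at the points of the support. -/

namespace ForestSkein

/-! ### Changing the colours -/

namespace CTree

variable {S : Type u} {S' : Type v} {α β : Type}

/-- Change the colours of the interior vertices. -/
def recolor (φ : S → S') : CTree S α → CTree S' α
  | leaf x => leaf x
  | node c l r => node (φ c) (l.recolor φ) (r.recolor φ)

theorem leaves_recolor (φ : S → S') (t : CTree S α) : (t.recolor φ).leaves = t.leaves := by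
  induction t with
  | leaf => rfl
  | node c l r hl hr => simp [recolor, leaves, hl, hr]

theorem recolor_bind (φ : S → S') (t : CTree S α) (g : α → CTree S β) :
    (t.bind g).recolor φ = (t.recolor φ).bind (fun x => (g x).recolor φ) := by
  induction t with
  | leaf => rfl
  | node c l r hl hr => simp [recolor, bind, hl, hr]

theorem recolor_recolor_unit (φ : Unit → S) (ψ : S → Unit) (t : CTree Unit α) :
    (t.recolor φ).recolor ψ = t := by
  induction t with
  | leaf => rfl
  | node c l r hl hr => simp [recolor, hl, hr]

/-- With a single colour, a left-vine remembers only its length. Through this, homogeneity of the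
presentation makes forgetting the colours well defined. -/
theorem recolor_leftVine (ψ : S → Unit) {w w' : List S} (h : w.length = w'.length) :
    (leftVine w).recolor ψ = (leftVine w').recolor ψ := by
  induction w generalizing w' with
  | nil => rw [List.eq_nil_of_length_eq_zero h.symm]
  | cons c w ih =>
    cases w' with
    | nil => simp at h
    | cons c' w' =>
      simp only [List.length_cons, Nat.add_right_cancel_iff] at h
      simp [leftVine, recolor, ih h, h]

/-! ### Left-vines carrying subtrees. -/

/-- Attach the trees `rs` to the right children of a left-vine and the tree `b` to its first
leaf. -/
def vine : List S → List (CTree S α) → CTree S α → CTree S α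
  | c :: w, r :: rs, b => node c (vine w rs b) r
  | _, _, b => b

theorem vine_append (w w' : List S) (rs rs' : List (CTree S α)) (b : CTree S α)
    (h : w.length = rs.length) :
    vine (w ++ w') (rs ++ rs') b = vine w rs (vine w' rs' b) := by
  induction w generalizing rs with
  | nil => rw [List.eq_nil_of_length_eq_zero h.symm]; rfl
  | cons c w ih =>
    cases rs with
    | nil => simp at h
    | cons r rs => simp [vine, ih rs (by simpa using h)]

/-- The labelling `g` does not depend on the word, so the same `g` serves both sides of a relation,
as `Step.base` requires. -/
theorem exists_vine_eq_bind (rs : List (CTree S α)) (b : CTree S α) :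
    ∃ g : ℕ → CTree S α, ∀ w : List S, w.length = rs.length → vine w rs b = (leftVine w).bind g := by
  induction rs with
  | nil =>
    refine ⟨fun _ => b, fun w h => ?_⟩
    rw [List.eq_nil_of_length_eq_zero h]
    rfl
  | cons r rs ih =>
    obtain ⟨g, hg⟩ := ih
    -- The right leaf of the root bears the number `rs.length + 1`, and the leaves of the remaining
    -- vine have smaller numbers, so the update does not disturb them.
    refine ⟨Function.update g (rs.length + 1) r, fun w h => ?_⟩
    cases w with
    | nil => simp at h
    | cons c w =>
      have h' : w.length = rs.length := by simpa using h
      simp only [vine, leftVine, bind, h', Function.update_self]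
      rw [hg w h', (leftVine w).bind_congr fun x hx => ?_]
      rw [leaves_leftVine, List.mem_range] at hx
      rw [Function.update_of_ne (by omega)]

end CTree

/-- A map between the colours of two skein presentations that is compatible with the relations. -/
structure Recoloring {S : Type u} {S' : Type v} (P : SkeinPresentation S)
    (P' : SkeinPresentation S') where
  color : S → S'
  map_rel : ∀ t s, P.rel t s → P'.TreeEquiv (t.recolor color) (s.recolor color)

theorem Recoloring.treeEquiv {S : Type u} {S' : Type v} {P : SkeinPresentation S}
    {P' : SkeinPresentation S'} (φ : Recoloring P P') {α : Type} {t s : CTree S α}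
    (h : P.TreeEquiv t s) : P'.TreeEquiv (t.recolor φ.color) (s.recolor φ.color) := by
  induction h with
  | rel t s h =>
    induction h with
    | base h g =>
      rw [CTree.recolor_bind, CTree.recolor_bind]
      exact (φ.map_rel _ _ h).bind fun _ => .refl _
    | left c r h ih => exact ih.node _ (.refl _)
    | right c l h ih => exact (SkeinPresentation.TreeEquiv.refl _).node _ ih
  | refl => exact .refl _
  | symm _ _ _ ih => exact ih.symm
  | trans _ _ _ _ _ h1 h2 => exact h1.trans h2

def VForest.recolor {S : Type u} {S' : Type v} {n m : ℕ} (φ : S → S') (f : VForest S n m) :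
    VForest S' n m where
  tree i := (f.tree i).recolor φ
  perm := by
    simp only [CTree.leaves_recolor]
    exact f.perm

namespace VHom

variable {S : Type u} {S' : Type v} {P : SkeinPresentation S} {P' : SkeinPresentation S'}
  (φ : Recoloring P P') {n m k : ℕ}

def recolor : VHom P n m → VHom P' n m :=
  Quotient.map (VForest.recolor φ.color) fun _ _ h i => φ.treeEquiv (h i)

theorem recolor_comp (f : VHom P n m) (g : VHom P m k) :
    (f.comp g).recolor φ = (f.recolor φ).comp (g.recolor φ) := by
  induction f using ind with
  | h f => induction g using ind with
  | h g =>
    change mk _ = mk _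
    congr 1
    simp [VForest.comp, VForest.recolor, CTree.recolor_bind]

theorem treeLeaves_recolor (f : VHom P n m) : (f.recolor φ).treeLeaves = f.treeLeaves := by
  induction f using ind with
  | h f => exact funext fun i => CTree.leaves_recolor _ _

theorem leaves_recolor (f : VHom P n m) : (f.recolor φ).leaves = f.leaves := by
  rw [leaves_eq_flatMap, leaves_eq_flatMap, treeLeaves_recolor]

theorem ord_recolor (f : VHom P n m) : (f.recolor φ).ord = f.ord :=
  ord_eq_of_leaves (by rw [leaves_recolor, map_ord])

theorem blockOrd_recolor (g : VHom P m k) (Q : Equiv.Perm (Fin m)) :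
    blockOrd (g.recolor φ) Q = blockOrd g Q := by
  apply ord_eq_of_leaves
  rw [map_blockOrd, leaves_comp, leaves_ofPerm, treeLeaves_recolor, List.flatMap_map]

/-- Cabling sees the forest only through the labels of the leaves of its trees, by way of
`blockOrd`. -/
theorem cable_recolor (g : VHom P m k) (β : BraidGroup m) (Q : Equiv.Perm (Fin m)) :
    cable (g.recolor φ) β Q = cable g β Q := by
  induction β using braid_induction generalizing Q with
  | one => rw [cable_one, cable_one]
  | gen i => simp only [cable_gen, blockLift, blockOrd_recolor]
  | mul β γ hβ hγ => rw [cable_mul, cable_mul, hβ, hγ]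
  | inv β hβ => rw [cable_inv, cable_inv, hβ]

end VHom

namespace FSHom

variable {S : Type u} {S' : Type v} {P : SkeinPresentation S} {P' : SkeinPresentation S'}

def recolor (φ : Recoloring P P') : (X : ThompsonType) → {n m : ℕ} → FSHom P X n m →
    FSHom P' X n m
  | .F, _, _, f => ⟨f.1.recolor φ, by rw [VHom.leaves_recolor, f.2]⟩
  | .T, _, _, f => ⟨f.1.recolor φ, by rw [VHom.leaves_recolor]; exact f.2⟩
  | .V, _, _, f => VHom.recolor φ f
  | .BV, _, _, f => ⟨(f.1.1.recolor φ, f.1.2), by rw [VHom.ord_recolor, f.2]⟩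

theorem recolor_id (φ : Recoloring P P') (X : ThompsonType) (n : ℕ) :
    recolor φ X (id X n) = id X n := by
  cases X <;> rfl

theorem recolor_comp (φ : Recoloring P P') (X : ThompsonType) {n m k : ℕ} (f : FSHom P X n m)
    (g : FSHom P X m k) : recolor φ X (comp X f g) = comp X (recolor φ X f) (recolor φ X g) := by
  cases X with
  | F => exact Subtype.ext (VHom.recolor_comp _ _ _)
  | T => exact Subtype.ext (VHom.recolor_comp _ _ _)
  | V => exact VHom.recolor_comp _ _ _
  | BV =>
    refine Subtype.ext (Prod.ext (VHom.recolor_comp _ _ _) ?_)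
    change cable g.1.1 f.1.2 1 * g.1.2 = cable (g.1.1.recolor φ) f.1.2 1 * g.1.2
    rw [VHom.cable_recolor]

end FSHom

/-- The functor between forest-skein categories given by a change of colours. -/
noncomputable def Recoloring.functor {S : Type u} {S' : Type v} {P : SkeinPresentation S}
    {P' : SkeinPresentation S'} (φ : Recoloring P P') (X : ThompsonType) :
    FSCat P X ⥤ FSCat P' X where
  obj n := ⟨n.n⟩
  map f := FSHom.recolor φ X f
  map_id n := FSHom.recolor_id φ X n.n
  map_comp f g := FSHom.recolor_comp φ X f g

/-! ### Uniform treatment of the four versions. -/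

namespace FSHom

variable {S : Type u} {S' : Type v} {P : SkeinPresentation S} {P' : SkeinPresentation S'}

/-- The forest with a permutation of its leaves underlying a morphism. -/
def toVHom : (X : ThompsonType) → {n m : ℕ} → FSHom P X n m → VHom P n m
  | .F, _, _, f => f.1
  | .T, _, _, f => f.1
  | .V, _, _, f => f
  | .BV, _, _, f => f.1.1

theorem toVHom_comp (X : ThompsonType) {n m k : ℕ} (f : FSHom P X n m) (g : FSHom P X m k) :
    toVHom X (comp X f g) = (toVHom X f).comp (toVHom X g) := by
  cases X <;> rfl

theorem toVHom_recolor (φ : Recoloring P P') (X : ThompsonType) {n m : ℕ} (f : FSHom P X n m) :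
    toVHom X (recolor φ X f) = (toVHom X f).recolor φ := by
  cases X <;> rfl

/-- Forests without permutation exist in all the versions of a forest-skein category. -/
def ofF : (X : ThompsonType) → {n m : ℕ} → FSHom P .F n m → FSHom P X n m
  | .F, _, _, f => f
  | .T, _, _, f => ⟨f.1, by rw [f.2]⟩
  | .V, _, _, f => f.1
  | .BV, _, m, f => ⟨(f.1, 1), by
      rw [map_one, inv_one]
      exact (VHom.ord_eq_of_leaves (by rw [f.2]; exact (List.map_id _).symm)).symm⟩

theorem toVHom_ofF (X : ThompsonType) {n m : ℕ} (f : FSHom P .F n m) :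
    toVHom X (ofF X f) = f.1 := by
  cases X <;> rfl

theorem recolor_ofF (φ : Recoloring P P') (X : ThompsonType) {n m : ℕ} (f : FSHom P .F n m) :
    recolor φ X (ofF X f) = ofF X (recolor φ .F f) := by
  cases X <;> rfl

end FSHom

/-- The functor to the `V`-version, acting as the identity on the numbers of leaves. -/
def vFunctor {S : Type u} (P : SkeinPresentation S) (X : ThompsonType) :
    FSCat P X ⥤ FSCat P .V where
  obj n := ⟨n.n⟩
  map f := FSHom.toVHom X f
  map_id n := by cases X <;> rfl
  map_comp f g := FSHom.toVHom_comp X f g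

/-- Replaces the definition by cases with a single functorial one, so that later arguments need not
distinguish the versions. -/
theorem Thompson.toV_eq (X : ThompsonType) : Thompson.toV X = fracMap (vFunctor mono X) ⟨1⟩ := by
  cases X
  case V => exact MonoidHom.ext fun v => by induction v using Quot.ind; rfl
  all_goals rfl

/-! ### The colours seen along the path to a leaf -/

namespace HPPresentation

variable {σ : Type u} (π : HPPresentation σ)

/-- Forgetting the colours. -/
def eraseColors : Recoloring π.skein mono where
  color _ := ()
  map_rel := by
    rintro _ _ ⟨w, w', h, rfl, rfl⟩
    rw [CTree.recolor_leftVine _ (π.homogeneous w w' h)]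
    exact .refl _

/-- Giving the colour `a` to all the vertices. -/
def constColor (a : σ) : Recoloring mono π.skein where
  color _ := a
  map_rel _ _ h := h.elim

/-- The element of `Mon⟨σ | ρ⟩` of a word. -/
abbrev ofWord (w : List σ) : π.Mon := PresentedMonoid.mk π.rel (FreeMonoid.ofList w)

theorem ofWord_cons (c : σ) (w : List σ) :
    π.ofWord (c :: w) = PresentedMonoid.of π.rel c * π.ofWord w := by
  rw [ofWord, FreeMonoid.ofList_cons, map_mul]
  rfl

theorem exists_ofWord (x : π.Mon) : ∃ w : List σ, π.ofWord w = x := by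
  obtain ⟨w, rfl⟩ := PresentedMonoid.surjective_mk x
  exact ⟨w.toList, rfl⟩

theorem lengthHom_of (c : σ) :
    π.lengthHom (PresentedMonoid.of π.rel c) = Multiplicative.ofAdd 1 := rfl

theorem lengthHom_ofWord (w : List σ) :
    π.lengthHom (π.ofWord w) = Multiplicative.ofAdd (w.length : ℤ) := by
  induction w with
  | nil => exact map_one _
  | cons c w ih =>
    rw [ofWord_cons, map_mul, ih, lengthHom_of, ← ofAdd_add, List.length_cons]
    congr 1
    push_cast
    ring

theorem length_eq_of_lengthHom_ofWord_eq {w w' : List σ}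
    (h : π.lengthHom (π.ofWord w) = π.lengthHom (π.ofWord w')) : w.length = w'.length := by
  rw [lengthHom_ofWord, lengthHom_ofWord] at h
  exact_mod_cast Multiplicative.ofAdd.injective h

/-- Words representing the same element of the monoid can be exchanged in left-vines. -/
theorem treeEquiv_vine {α : Type} {w w' : List σ} (h : π.ofWord w = π.ofWord w')
    (rs : List (CTree σ α)) (hrs : w.length = rs.length) (b : CTree σ α) :
    π.skein.TreeEquiv (CTree.vine w rs b) (CTree.vine w' rs b) := by
  -- Induction on the generated congruence. Equality of lengths is carried along because both words
  -- must use up the list `rs` in the same way, and `rs`, `b` stay general because the product case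
  -- splits them.
  have key : ∀ x y : FreeMonoid σ, ConGen.Rel π.rel x y → x.toList.length = y.toList.length ∧
      ∀ (rs : List (CTree σ α)) (b : CTree σ α), x.toList.length = rs.length →
        π.skein.TreeEquiv (CTree.vine x.toList rs b) (CTree.vine y.toList rs b) := by
    intro x y hxy
    induction hxy with
    | of x y hxy =>
      have hl : x.toList.length = y.toList.length := π.homogeneous x y hxy
      refine ⟨hl, fun rs b hx => ?_⟩
      obtain ⟨g, hg⟩ := CTree.exists_vine_eq_bind rs b
      rw [hg _ hx, hg _ (hl ▸ hx)]
      exact .rel _ _ (SkeinPresentation.Step.base (P := π.skein) (t := leftVine x.toList)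
        (s := leftVine y.toList) ⟨x, y, hxy, rfl, rfl⟩ g)
    | refl => exact ⟨rfl, fun _ _ _ => .refl _⟩
    | symm _ ih => exact ⟨ih.1.symm, fun rs b hx => (ih.2 rs b (ih.1.trans hx)).symm⟩
    | trans _ _ ih ih' =>
      exact ⟨ih.1.trans ih'.1, fun rs b hx =>
        (ih.2 rs b hx).trans (ih'.2 rs b (ih.1.symm.trans hx))⟩
    | @mul x y z t _ _ ih ih' =>
      simp only [FreeMonoid.toList_mul, List.length_append]
      refine ⟨by rw [ih.1, ih'.1], fun rs b hx => ?_⟩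
      -- The letters of `x` form the part of the vine next to the root and carry the first right
      -- subtrees. The letters of `z` carry the others.
      have h1 : x.toList.length = (rs.take x.toList.length).length := by
        rw [List.length_take]; omega
      have h2 : z.toList.length = (rs.drop x.toList.length).length := by
        rw [List.length_drop]; omega
      rw [← List.take_append_drop x.toList.length rs, CTree.vine_append _ _ _ _ _ h1,
        CTree.vine_append _ _ _ _ _ (ih.1 ▸ h1)]
      refine (ih.2 _ _ h1).trans ?_
      have hc : ∀ (w : List σ) (rs : List (CTree σ α)) {b b' : CTree σ α},
          π.skein.TreeEquiv b b' → π.skein.TreeEquiv (CTree.vine w rs b) (CTree.vine w rs b') := by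
        intro w
        induction w with
        | nil => intro rs b b' hb; exact hb
        | cons c w ihw =>
          intro rs b b' hb
          cases rs with
          | nil => exact hb
          | cons r rs => exact (ihw rs hb).node c (.refl r)
      exact hc _ _ (ih'.2 _ _ h2)
  have h' : ((FreeMonoid.ofList w : FreeMonoid σ) : (conGen π.rel).Quotient) =
    (FreeMonoid.ofList w' : FreeMonoid σ) := h
  exact (key _ _ ((Con.eq _).1 h')).2 rs b hrs

/-- The product of the colours along the path from the root of a tree to the leaf whose standard
dyadic interval contains `q`, where all the vertices are considered to have colour `a` apart from
those whose interval has `q` as its left endpoint. -/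
def pathColor (a : σ) {α : Type} : CTree σ α → Q2 → π.Mon
  | .leaf _, _ => 1
  | .node c l r, q =>
    if q.1 < 1 / 2 then
      PresentedMonoid.of π.rel (if q.1 = 0 then c else a) * pathColor a l q.double
    else PresentedMonoid.of π.rel a * pathColor a r q.double

end HPPresentation

/-- Along left edges the test "is the point the left endpoint of the interval" has a constant
answer: once colours are read, they are read down to the end of the vine, and reading can begin only
after a right turn. -/
theorem Q2.double_eq_zero_iff {q : Q2} (h : q.1 < 1 / 2) : q.double.1 = 0 ↔ q.1 = 0 := by
  simp only [Q2.double, if_pos h]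
  simp

namespace HPPresentation

variable {σ : Type u} (π : HPPresentation σ) (a : σ) {α β : Type}

/-- The path crosses `t` and then the tree grafted at the leaf reached. Whether a vertex is read
with its colour depends only on the rescaled point, so the second factor is a path colour of the
grafted tree. -/
theorem pathColor_bind (t : CTree σ α) (g : α → CTree σ β) (q : Q2) :
    π.pathColor a (t.bind g) q =
      π.pathColor a t q * π.pathColor a (g (t.walk q).1) (t.walk q).2 := by
  induction t generalizing q with
  | leaf x => simp [CTree.bind, CTree.walk, pathColor]
  | node c l r hl hr =>
    simp only [CTree.bind, pathColor, CTree.walk]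
    by_cases h : q.1 < 1 / 2
    · simp only [if_pos h, hl, mul_assoc]
    · simp only [if_neg h, hr, mul_assoc]

/-- Each vertex on the path contributes one letter, whether its own colour or `a`. This ties lengths
in the monoid to slopes. -/
theorem lengthHom_pathColor (t : CTree σ α) (q : Q2) :
    π.lengthHom (π.pathColor a t q) = Multiplicative.ofAdd (t.depth q : ℤ) := by
  induction t generalizing q with
  | leaf x => exact map_one _
  | node c l r hl hr =>
    simp only [pathColor, CTree.depth]
    split_ifs <;> rw [map_mul, lengthHom_of] <;> simp only [hl, hr] <;> rw [← ofAdd_add] <;>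
      congr 1 <;> push_cast <;> ring

/-- Away from the left endpoints of the dyadic intervals of the leaves, the colours are not
seen. -/
theorem pathColor_eq_pow (t : CTree σ α) (q : Q2) (h : (t.walk q).2.1 ≠ 0) :
    π.pathColor a t q = PresentedMonoid.of π.rel a ^ t.depth q := by
  induction t generalizing q with
  | leaf x => simp [pathColor, CTree.depth]
  | node c l r hl hr =>
    simp only [pathColor, CTree.depth, CTree.walk] at h ⊢
    by_cases h1 : q.1 < 1 / 2
    · simp only [if_pos h1] at h ⊢
      rw [hl _ h, pow_succ']
      split_ifs with h0
      -- A true colour is read only when the point is the left endpoint of the vertex's interval,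
      -- but from there the walk stays on left edges and ends at the left endpoint of a leaf, which
      -- is excluded.
      · have : ∀ (t : CTree σ α) (q : Q2), q.1 = 0 → (t.walk q).2.1 = 0 := by
          intro t
          induction t with
          | leaf x => exact fun q hq => hq
          | node c l r hl hr =>
            intro q hq
            have hq' : q.1 < 1 / 2 := by rw [hq]; norm_num
            simp only [CTree.walk, if_pos hq']
            exact hl _ ((Q2.double_eq_zero_iff hq').2 hq)
        exact absurd (this l _ ((Q2.double_eq_zero_iff h1).2 h0)) h
      · rfl
    · simp only [if_neg h1] at h ⊢
      rw [hr _ h, pow_succ']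

theorem pathColor_constColor (t : CTree Unit α) (q : Q2) :
    π.pathColor a (t.recolor (π.constColor a).color) q =
      PresentedMonoid.of π.rel a ^ t.depth q := by
  induction t generalizing q with
  | leaf x => simp [CTree.recolor, pathColor, CTree.depth]
  | node c l r hl hr =>
    simp only [CTree.recolor, pathColor, CTree.depth, constColor, ite_self, pow_succ'] at *
    split_ifs
    · rw [hl]
    · rw [hr]

theorem pathColor_leftVine_zero (w : List σ) (e : ℕ → α) {q : Q2} (hq : q.1 = 0) :
    π.pathColor a ((leftVine w).bind fun i => .leaf (e i)) q = π.ofWord w := by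
  induction w generalizing q with
  | nil => exact (map_one _).symm
  | cons c w ih =>
    have hq' : q.1 < 1 / 2 := by rw [hq]; norm_num
    simp only [leftVine, CTree.bind, pathColor, if_pos hq', if_pos hq, ofWord_cons]
    rw [ih ((Q2.double_eq_zero_iff hq').2 hq)]

/-- All vertices of a left-vine have intervals starting at 0, so no other point reads any of its
colours. -/
theorem pathColor_leftVine (w : List σ) (e : ℕ → α) {q : Q2} (hq : q.1 ≠ 0) :
    π.pathColor a ((leftVine w).bind fun i => .leaf (e i)) q =
      PresentedMonoid.of π.rel a ^ ((leftVine w).bind fun i => .leaf (e i)).depth q := by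
  induction w generalizing q with
  | nil => simp [leftVine, CTree.bind, pathColor, CTree.depth]
  | cons c w ih =>
    simp only [leftVine, CTree.bind, pathColor, if_neg hq, CTree.depth]
    split_ifs with h
    · rw [ih (by rwa [Ne, Q2.double_eq_zero_iff h]), pow_succ']
    · rw [zero_add, pow_one, mul_one]

end HPPresentation

namespace CTree

variable {S : Type u} {S' : Type v} {α β : Type}

theorem walk_recolor (φ : S → S') (t : CTree S α) (q : Q2) : (t.recolor φ).walk q = t.walk q := by
  induction t generalizing q with
  | leaf x => rfl
  | node c l r hl hr => simp only [recolor, walk, hl, hr]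

theorem depth_recolor (φ : S → S') (t : CTree S α) (q : Q2) :
    (t.recolor φ).depth q = t.depth q := by
  induction t generalizing q with
  | leaf x => rfl
  | node c l r hl hr => simp only [recolor, depth, hl, hr]

end CTree

/-! ### Invariance of the path colours under the skein relations. -/

namespace HPPresentation

variable {σ : Type u} (π : HPPresentation σ) (a : σ) {α β : Type}

theorem walk_eq_of_erase_eq {t s : CTree σ α}
    (h : t.recolor π.eraseColors.color = s.recolor π.eraseColors.color) (q : Q2) :
    t.walk q = s.walk q := by
  rw [← CTree.walk_recolor π.eraseColors.color, h, CTree.walk_recolor]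

theorem depth_eq_of_erase_eq {t s : CTree σ α}
    (h : t.recolor π.eraseColors.color = s.recolor π.eraseColors.color) (q : Q2) :
    t.depth q = s.depth q := by
  rw [← CTree.depth_recolor π.eraseColors.color, h, CTree.depth_recolor]

/-- Where a relation is applied, the left endpoint reads the two words, which are equal in the
monoid. Every other point reads a power of `a`, and the exponents agree since the shapes do. Below
the vine both trees continue identically. -/
theorem pathColor_eq_of_treeEquiv {t s : CTree σ α} (h : π.skein.TreeEquiv t s) (q : Q2) :
    π.pathColor a t q = π.pathColor a s q := by
  induction h generalizing q with
  | rel t s h =>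
    induction h generalizing q with
    | base h g =>
      obtain ⟨w, w', h, rfl, rfl⟩ := h
      have he : ∀ w : FreeMonoid σ, (leftVine w.toList).bind (fun i => .leaf i) =
          leftVine w.toList := fun w => CTree.bind_leaf _
      have hr : (leftVine w.toList).recolor π.eraseColors.color =
          (leftVine w'.toList).recolor π.eraseColors.color :=
        CTree.recolor_leftVine _ (π.homogeneous w w' h)
      rw [pathColor_bind, pathColor_bind, π.walk_eq_of_erase_eq hr]
      congr 1
      by_cases hq : q.1 = 0
      · rw [← he w, ← he w', pathColor_leftVine_zero _ _ _ _ hq,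
          pathColor_leftVine_zero _ _ _ _ hq]
        exact (Con.eq _).2 (ConGen.Rel.of _ _ h)
      · have h1 := π.pathColor_leftVine a w.toList (fun i => i) hq
        have h2 := π.pathColor_leftVine a w'.toList (fun i => i) hq
        rw [he] at h1 h2
        rw [h1, h2, π.depth_eq_of_erase_eq hr]
    | left c r h ih => simp only [pathColor, ih]
    | right c l h ih => simp only [pathColor, ih]
  | refl => rfl
  | symm _ _ _ ih => exact (ih q).symm
  | trans _ _ _ _ _ h1 h2 => exact (h1 q).trans (h2 q)

variable [IsOreMonoid π.Mon]

/-! ### Reconstruction of a diagram from its shape and path colours. -/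

/-- A tree can be recovered from its shape and the elements of the monoid given by its maximal
left-vines. -/
theorem exists_vine_of_pathColor_eq {t s : CTree σ α}
    (h : t.recolor π.eraseColors.color = s.recolor π.eraseColors.color)
    (hc : ∀ q : Q2, q.1 ≠ 0 → π.pathColor a t q = π.pathColor a s q) :
    ∃ (w w' : List σ) (rs : List (CTree σ α)) (b : CTree σ α),
      w.length = rs.length ∧ t = CTree.vine w rs b ∧ π.skein.TreeEquiv s (CTree.vine w' rs b) ∧
      ∀ q : Q2, q.1 = 0 → π.pathColor a t q = π.ofWord w ∧ π.pathColor a s q = π.ofWord w' := by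
  induction t generalizing s with
  | leaf x =>
    cases s with
    | node => simp [CTree.recolor] at h
    | leaf y =>
      obtain rfl : x = y := by simpa [CTree.recolor] using h
      refine ⟨[], [], [], .leaf x, rfl, rfl, .refl _, fun _ _ => ⟨(map_one _).symm, (map_one _).symm⟩⟩
  | node c l r hl hr =>
    cases s with
    | leaf => simp [CTree.recolor] at h
    | node c' l' r' =>
      simp only [CTree.recolor, CTree.node.injEq] at h
      have hf := fun q => Q2.half_lt false q
      have ht := fun q => Q2.half_lt true q
      simp only [Bool.true_eq_false, iff_true, iff_false] at hf ht
      -- A nonzero point of the left half reads the root as `a`, which can be cancelled. At 0 the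
      -- two root colours may differ, which is why the hypothesis concerns nonzero points only and
      -- the two words of the main vine are left undetermined.
      obtain ⟨w, w', rs, b, hw, rfl, hs, h0⟩ := hl h.2.1 fun q hq => by
        have hne : (q.half false).1 ≠ 0 := by simpa [Q2.half] using hq
        have := hc (q.half false) hne
        simp only [pathColor, if_pos (hf q), if_neg hne, Q2.double_half] at this
        exact IsOreMonoid.left_cancel _ _ _ this
      -- Every point of the right half is nonzero, so the right subtrees agree at all points,
      -- including their own left endpoint. Their main vines then represent the same element and the
      -- subtrees are equivalent.
      have hcr : ∀ q, π.pathColor a r q = π.pathColor a r' q := fun q => by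
        have hne : (q.half true).1 ≠ 0 := fun h0 => ht q (by rw [h0]; norm_num)
        have := hc (q.half true) hne
        simp only [pathColor, if_neg (ht q), Q2.double_half] at this
        exact IsOreMonoid.left_cancel _ _ _ this
      obtain ⟨v, v', rs', b', hv, rfl, hs', h0'⟩ := hr h.2.2 fun q _ => hcr q
      have hz : ((⟨0, le_rfl, one_pos, 0, 0, by simp⟩ : Q2)).1 = 0 := rfl
      have hvv := (h0' _ hz).1.symm.trans ((hcr _).trans (h0' _ hz).2)
      have hrr := (π.treeEquiv_vine hvv rs' hv b').trans hs'.symm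
      refine ⟨c :: w, c' :: w', _ :: rs, b, by simp [hw], rfl, hs.node c' hrr.symm, ?_⟩
      intro q hq
      have hq' : q.1 < 1 / 2 := by rw [hq]; norm_num
      have := h0 q.double ((Q2.double_eq_zero_iff hq').2 hq)
      simp only [pathColor, if_pos hq', if_pos hq, this, ofWord_cons, and_self]

theorem treeEquiv_of_pathColor_eq {t s : CTree σ α}
    (h : t.recolor π.eraseColors.color = s.recolor π.eraseColors.color)
    (hc : ∀ q : Q2, π.pathColor a t q = π.pathColor a s q) : π.skein.TreeEquiv t s := by
  obtain ⟨w, w', rs, b, hw, rfl, hs, h0⟩ := π.exists_vine_of_pathColor_eq a h fun q _ => hc q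
  have hz : ((⟨0, le_rfl, one_pos, 0, 0, by simp⟩ : Q2)).1 = 0 := rfl
  have := (h0 _ hz).1.symm.trans ((hc _).trans (h0 _ hz).2)
  exact (π.treeEquiv_vine this rs hw b).trans hs.symm

end HPPresentation

instance : Zero Q2 := ⟨⟨0, le_rfl, one_pos, 0, 0, by simp⟩⟩

theorem Q2.val_eq_zero_iff {q : Q2} : q.1 = 0 ↔ q = 0 := ⟨fun h => Subtype.ext h, fun h => by rw [h]; rfl⟩

/-! ### Shapes and path colours of classes of forests. -/

namespace VHom

section Straighten

variable {S : Type u} {S' : Type v} {P : SkeinPresentation S} {P' : SkeinPresentation S'}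
  {n m : ℕ}

/-- The forest obtained by removing the permutation on top of a diagram. -/
def straighten (f : VHom P n m) : FSHom P .F n m := ⟨f.comp (ofPerm f.ord⁻¹), by
  have h : (ofPerm f.ord⁻¹ : VHom P m m).treeLeaves = fun i => [f.ord⁻¹ i] := rfl
  rw [leaves_comp, ← map_ord f, h, ← List.map_eq_flatMap, List.map_map, ← Equiv.Perm.coe_mul,
    inv_mul_cancel]
  exact List.map_id _⟩

theorem recolor_straighten (φ : Recoloring P P') (f : VHom P n m) :
    f.straighten.1.recolor φ = (f.recolor φ).straighten.1 := by
  simp only [straighten]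
  rw [recolor_comp, ord_recolor]
  rfl

/-- The permutation removed has only trivial trees: it relabels leaves and rescales nothing. -/
theorem walk_straighten_snd (f : VHom mono n m) (b : Fin n × Q2) :
    (f.straighten.1.walk b).2 = (f.walk b).2 := by
  rw [straighten, walk_comp]
  rfl

end Straighten

variable {σ : Type u} {π : HPPresentation σ} (a : σ) {n m k : ℕ}

/-- The monochromatic forest obtained by forgetting the colours. -/
def erase (f : VHom π.skein n m) : VHom mono n m := f.recolor π.eraseColors

theorem erase_comp (f : VHom π.skein n m) (g : VHom π.skein m k) :
    (f.comp g).erase = f.erase.comp g.erase := recolor_comp _ _ _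

theorem erase_constColor (f : VHom mono n m) : (f.recolor (π.constColor a)).erase = f := by
  induction f using ind with
  | h f =>
    change mk _ = mk _
    congr 1
    simp [VForest.recolor, CTree.recolor_recolor_unit]

/-- The product of the colours along the path from a root to a leaf. -/
def pathColor : VHom π.skein n m → Fin n × Q2 → π.Mon :=
  Quotient.lift (fun f b => π.pathColor a (f.tree b.1) b.2) fun _ _ h =>
    funext fun b => π.pathColor_eq_of_treeEquiv a (h b.1) b.2

theorem pathColor_comp (f : VHom π.skein n m) (g : VHom π.skein m k) (b : Fin n × Q2) :
    (f.comp g).pathColor a b = f.pathColor a b * g.pathColor a (f.erase.walk b) := by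
  induction f using ind with
  | h f => induction g using ind with
  | h g =>
    refine (π.pathColor_bind a (f.tree b.1) g.tree b.2).trans ?_
    rw [← CTree.walk_recolor π.eraseColors.color]
    rfl

theorem lengthHom_pathColor (f : VHom π.skein n m) (b : Fin n × Q2) :
    π.lengthHom (f.pathColor a b) = Multiplicative.ofAdd (f.erase.depth b : ℤ) := by
  induction f using ind with
  | h f =>
    refine (π.lengthHom_pathColor a (f.tree b.1) b.2).trans ?_
    rw [← CTree.depth_recolor π.eraseColors.color]
    rfl

theorem pathColor_eq_pow (f : VHom π.skein n m) (b : Fin n × Q2) (h : (f.erase.walk b).2 ≠ 0) :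
    f.pathColor a b = PresentedMonoid.of π.rel a ^ f.erase.depth b := by
  induction f using ind with
  | h f =>
    change (((f.tree b.1).recolor π.eraseColors.color).walk b.2).2 ≠ 0 at h
    rw [CTree.walk_recolor] at h
    refine (π.pathColor_eq_pow a (f.tree b.1) b.2 fun h' => h (Q2.val_eq_zero_iff.1 h')).trans ?_
    rw [← CTree.depth_recolor π.eraseColors.color]
    rfl

theorem pathColor_constColor (f : VHom mono n m) (b : Fin n × Q2) :
    (f.recolor (π.constColor a)).pathColor a b = PresentedMonoid.of π.rel a ^ f.depth b := by
  induction f using ind with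
  | h f => exact π.pathColor_constColor a (f.tree b.1) b.2

theorem pathColor_straighten (f : VHom π.skein n m) (b : Fin n × Q2) :
    f.straighten.1.pathColor a b = f.pathColor a b := by
  rw [straighten, pathColor_comp]
  exact mul_one _

/-- A diagram is determined by its shape and the elements of the monoid along its left-vines. -/
theorem ext_pathColor [IsOreMonoid π.Mon] {f g : VHom π.skein n m} (h : f.erase = g.erase)
    (hc : ∀ b, f.pathColor a b = g.pathColor a b) : f = g := by
  induction f using ind with
  | h f => induction g using ind with
  | h g =>
    exact Quotient.sound (s := forestSetoid π.skein n m) fun i =>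
      π.treeEquiv_of_pathColor_eq a
        (mono_treeEquiv (Quotient.exact (s := forestSetoid mono n m) h i)) fun q => hc (i, q)

end VHom

/-! ### Forests of left-vines with prescribed words. -/

/-- A numbering of the leaves of a family of left-vines. -/
theorem exists_vineLabels {m : ℕ} (ℓ : Fin m → ℕ) :
    ∃ (k : ℕ) (e : Fin m → ℕ → Fin k), ((List.finRange m).flatMap fun j =>
      (List.range (ℓ j + 1)).map (e j)).Perm (List.finRange k) := by
  let e := Fintype.equivFin (Σ j : Fin m, Fin (ℓ j + 1))
  -- `Fin.ofNat` reduces modulo `ℓ j + 1`. Only the indices up to `ℓ j` occur on the leaves, and on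
  -- these it changes nothing.
  refine ⟨_, fun j i => e ⟨j, Fin.ofNat (ℓ j + 1) i⟩,
    (List.perm_ext_iff_of_nodup ?_ (List.nodup_finRange _)).2 fun x => ?_⟩
  · refine List.nodup_flatMap.2 ⟨fun j _ => ?_, (List.nodup_finRange m).imp fun {i j} hij => ?_⟩
    · refine List.Nodup.map_on (fun x hx y hy hxy => ?_) List.nodup_range
      rw [List.mem_range] at hx hy
      have h := e.injective hxy
      simp only [Sigma.mk.injEq, heq_eq_eq, true_and] at h
      have := congrArg Fin.val h
      simpa [Nat.mod_eq_of_lt hx, Nat.mod_eq_of_lt hy] using this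
    · intro x hx hx'
      obtain ⟨y, -, rfl⟩ := List.mem_map.1 hx
      obtain ⟨y', -, h⟩ := List.mem_map.1 hx'
      exact hij (congrArg Sigma.fst (e.injective h)).symm
  · simp only [List.mem_finRange, iff_true, List.mem_flatMap, true_and, List.mem_map, List.mem_range]
    refine ⟨(e.symm x).1, (e.symm x).2, (e.symm x).2.isLt, ?_⟩
    rw [← Equiv.eq_symm_apply]
    refine Sigma.ext rfl (heq_of_eq (Fin.ext ?_))
    simp

namespace HPPresentation

variable {σ : Type u} (π : HPPresentation σ) (a : σ)

/-- Two forests of left-vines with the same shape and prescribed colours. -/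
theorem exists_vines {m : ℕ} (x y : Fin m → π.Mon)
    (h : ∀ j, π.lengthHom (x j) = π.lengthHom (y j)) :
    ∃ (k : ℕ) (p p' : FSHom π.skein .F m k), p.1.erase = p'.1.erase ∧
      (∀ j, p.1.pathColor a (j, 0) = x j ∧ p'.1.pathColor a (j, 0) = y j) ∧
      ∀ b, b.2 ≠ 0 → p.1.pathColor a b = p'.1.pathColor a b := by
  choose u hu using fun j => π.exists_ofWord (x j)
  choose w hw using fun j => π.exists_ofWord (y j)
  -- Equal lengths let a single numbering of the leaves serve both families, so the two forests have
  -- the same shape.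
  have hl : ∀ j, (u j).length = (w j).length := fun j =>
    π.length_eq_of_lengthHom_ofWord_eq (by rw [hu, hw, h])
  obtain ⟨k, e, he⟩ := exists_vineLabels fun j => (u j).length
  have hleaves : ∀ (v : List σ) (j : Fin m), ((leftVine v).bind fun i => .leaf (e j i)).leaves =
      (List.range (v.length + 1)).map (e j) := by
    intro v j
    rw [CTree.leaves_bind, leaves_leftVine, List.map_eq_flatMap]
    rfl
  let f : VForest σ m k := ⟨fun j => (leftVine (u j)).bind fun i => .leaf (e j i), by
    simpa only [hleaves] using he⟩
  let g : VForest σ m k := ⟨fun j => (leftVine (w j)).bind fun i => .leaf (e j i), by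
    simpa only [hleaves, ← hl] using he⟩
  have hshape : ∀ j, (f.tree j).recolor π.eraseColors.color =
      (g.tree j).recolor π.eraseColors.color := fun j => by
    simp only [f, g, CTree.recolor_bind]
    rw [CTree.recolor_leftVine π.eraseColors.color (hl j)]
  have herase : (VHom.mk f : VHom π.skein m k).erase = (VHom.mk g : VHom π.skein m k).erase :=
    congrArg VHom.mk (by simp only [VForest.recolor, hshape])
  -- Straightening yields forests without permutation, available in every version. Both shapes are
  -- straightened identically and path colours do not change.
  refine ⟨k, (VHom.mk f).straighten, (VHom.mk g).straighten, ?_, fun j => ?_, fun b hb => ?_⟩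
  · rw [VHom.erase, VHom.erase, VHom.recolor_straighten, VHom.recolor_straighten]
    exact congrArg (fun f => f.straighten.1) herase
  · rw [VHom.pathColor_straighten, VHom.pathColor_straighten]
    exact ⟨(π.pathColor_leftVine_zero a _ _ rfl).trans (hu j),
      (π.pathColor_leftVine_zero a _ _ rfl).trans (hw j)⟩
  · rw [VHom.pathColor_straighten, VHom.pathColor_straighten]
    have hb' : b.2.1 ≠ 0 := fun h => hb (Q2.val_eq_zero_iff.1 h)
    refine (π.pathColor_leftVine a (u b.1) (e b.1) hb').trans ?_
    refine Eq.trans ?_ (π.pathColor_leftVine a (w b.1) (e b.1) hb').symm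
    exact congrArg _ (π.depth_eq_of_erase_eq (hshape b.1) b.2)

/-! ### The Ore property. -/

variable [IsOreMonoid π.Mon]

/-- Two diagrams of the same shape become equal when suitable left-vines are added to
their leaves. -/
theorem exists_comp_vines_eq {n m : ℕ} {f g : VHom π.skein n m} (hfg : f.erase = g.erase)
    (x y : Fin m → π.Mon) (h : ∀ j, f.pathColor a (f.erase.walk.symm (j, 0)) * x j =
      g.pathColor a (f.erase.walk.symm (j, 0)) * y j) :
    ∃ (k : ℕ) (p p' : FSHom π.skein .F m k), f.comp p.1 = g.comp p'.1 ∧ (x = y → p = p') := by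
  -- The path colours of `f` and `g` at the same point have the same length, namely the common
  -- depth, so the multipliers have equal lengths too.
  have hlen : ∀ j, π.lengthHom (x j) = π.lengthHom (y j) := fun j => by
    have := congrArg π.lengthHom (h j)
    rw [map_mul, map_mul, VHom.lengthHom_pathColor, VHom.lengthHom_pathColor, hfg] at this
    exact mul_left_cancel this
  obtain ⟨k, p, p', he, h0, h1⟩ := π.exists_vines a x y hlen
  refine ⟨k, p, p', VHom.ext_pathColor a ?_ fun b => ?_, fun hxy => Subtype.ext ?_⟩
  · rw [VHom.erase_comp, VHom.erase_comp, hfg, he]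
  · rw [VHom.pathColor_comp, VHom.pathColor_comp, ← hfg]
    -- At the left endpoint of a leaf of `f` the assumed equation in the monoid applies. Elsewhere
    -- `f` and `g` contribute the same power of `a`, and the two vine forests agree.
    by_cases hb : (f.erase.walk b).2 = 0
    · have hb' : f.erase.walk b = ((f.erase.walk b).1, 0) := Prod.ext rfl hb
      have hj := h (f.erase.walk b).1
      rw [← hb', Equiv.symm_apply_apply] at hj
      rw [hb', (h0 _).1, (h0 _).2, hj]
    · rw [h1 _ hb, VHom.pathColor_eq_pow a f b hb, VHom.pathColor_eq_pow a g b (hfg ▸ hb), hfg]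
  -- This clause is for the kernel computation, where both terms of a fraction must be multiplied by
  -- the same morphism.
  · refine VHom.ext_pathColor a he fun b => ?_
    by_cases hb : b.2 = 0
    · obtain ⟨j, q⟩ := b
      obtain rfl : q = 0 := hb
      rw [(h0 j).1, (h0 j).2, hxy]
    · exact h1 b hb

/-- Both axioms split into one for the monochromatic category, applied to shapes, and one for the
monoid, applied pointwise to path colours. -/
theorem skein_isOre_V (a : σ) : IsOreCategory (FSCat π.skein .V) := by
  constructor
  · rintro ⟨n⟩ ⟨m⟩ ⟨k⟩ f g g' e
    change VHom π.skein n m at f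
    change VHom π.skein m k at g g'
    change f.comp g = f.comp g' at e
    have he : g.erase = g'.erase := by
      have := congrArg VHom.erase e
      rw [VHom.erase_comp, VHom.erase_comp] at this
      exact mono_isOre_V.left_cancel (x := ⟨n⟩) (y := ⟨m⟩) (z := ⟨k⟩) _ _ _ this
    refine VHom.ext_pathColor a he fun b => ?_
    have h := congrArg (fun h => h.pathColor a (f.erase.walk.symm b)) e
    simp only [VHom.pathColor_comp, Equiv.apply_symm_apply] at h
    exact IsOreMonoid.left_cancel _ _ _ h
  · rintro ⟨n⟩ ⟨m⟩ ⟨m'⟩ f g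
    change VHom π.skein n m at f
    change VHom π.skein n m' at g
    obtain ⟨⟨l⟩, p, q, hpq⟩ := mono_isOre_V.common_multiple (x := ⟨n⟩) (y := ⟨m⟩) (z := ⟨m'⟩)
      f.erase g.erase
    change VHom mono m l at p
    change VHom mono m' l at q
    change f.erase.comp p = g.erase.comp q at hpq
    have hfg : (f.comp (p.recolor (π.constColor a))).erase =
        (g.comp (q.recolor (π.constColor a))).erase := by
      rw [VHom.erase_comp, VHom.erase_comp, VHom.erase_constColor, VHom.erase_constColor, hpq]
    -- The multiples have been given the same shape by adding vertices of colour `a`. It remains to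
    -- equalise the colours read at the left endpoint of each leaf.
    choose x y hxy using fun j : Fin l => IsOreMonoid.common_multiple
      ((f.comp (p.recolor (π.constColor a))).pathColor a
        ((f.comp (p.recolor (π.constColor a))).erase.walk.symm (j, 0)))
      ((g.comp (q.recolor (π.constColor a))).pathColor a
        ((f.comp (p.recolor (π.constColor a))).erase.walk.symm (j, 0)))
    obtain ⟨k, r, r', h, -⟩ := π.exists_comp_vines_eq a hfg x y hxy
    refine ⟨⟨k⟩, (p.recolor (π.constColor a)).comp r.1, (q.recolor (π.constColor a)).comp r'.1, ?_⟩
    change f.comp _ = g.comp _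
    rw [← VHom.comp_assoc, h, VHom.comp_assoc]

instance [Nonempty σ] (X : ThompsonType) : IsOreCategory (FSCat π.skein X) :=
  isOre_of_V π.skein (π.skein_isOre_V (Classical.arbitrary σ)) X

end HPPresentation

/-- "Some morphism equalises numerator and denominator" is invariant under the moves generating
equality of fractions, thanks to common multiples. It therefore descends to the quotient, where it
holds at 1. -/
theorem exists_comp_eq_of_frac_eq_one {C : Type u} [Category.{v} C] [IsOreCategory C] {x y : C}
    {f g : x ⟶ y} (h : frac f g = (1 : FracGroup C x)) : ∃ (z : C) (p : y ⟶ z), f ≫ p = g ≫ p := by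
  let E : FracGroup C x → Prop := Quot.lift (fun P => ∃ (z : C) (p : P.tgt ⟶ z),
    P.num ≫ p = P.den ≫ p) (by
      rintro P _ ⟨z, r, rfl⟩
      apply propext
      constructor
      · rintro ⟨w, p, hp⟩
        obtain ⟨w', s, t, hst⟩ := IsOreCategory.common_multiple p r
        refine ⟨w', t, ?_⟩
        rw [Category.assoc, Category.assoc, ← hst, ← Category.assoc, hp, Category.assoc]
      · rintro ⟨w, p, hp⟩
        exact ⟨w, r ≫ p, by simpa using hp⟩)
  have h1 : E 1 := ⟨x, 𝟙 x, rfl⟩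
  exact (congrArg E h).mpr h1

/-! ### The fraction group of an Ore monoid. -/

namespace Frac

variable {M : Type u} [Monoid M]

theorem mk_mul_right (x y z : M) : Frac.mk (x * z) (y * z) = Frac.mk x y :=
  frac_comp (C := MonoidCat M) (x := .star) (y := .star) (z := .star) x y z

theorem exists_mk (k : Frac M) : ∃ x y : M, Frac.mk x y = k := by
  obtain ⟨_, x, y, rfl⟩ := FracGroup.exists_rep k
  exact ⟨x, y, rfl⟩

variable [IsOreMonoid M]

/-- The canonical morphism from an Ore monoid to its fraction group. -/
noncomputable def ofMonoid : M →* Frac M where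
  toFun x := Frac.mk x 1
  map_one' := rfl
  map_mul' x y := by
    refine Eq.symm ((frac_mul (C := MonoidCat M) (x := .star) (y := .star) (y' := .star)
      (w := .star) x (1 : M) y (1 : M) y (1 : M) ?_).trans ?_)
    · exact (one_mul y).trans (mul_one y).symm
    · change Frac.mk (x * y) (1 * 1) = _
      rw [one_mul]

theorem mk_eq (x y : M) : Frac.mk x y = ofMonoid x * (ofMonoid y)⁻¹ :=
  (frac_mul_same (C := MonoidCat M) (x := .star) (y := .star) x (1 : M) y).symm

theorem mk_mul_mk (x y z : M) : Frac.mk x y * Frac.mk y z = Frac.mk x z :=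
  frac_mul_same (C := MonoidCat M) (x := .star) (y := .star) x y z

theorem exists_mul_eq_of_mk_eq_one {x y : M} (h : Frac.mk x y = 1) : ∃ r, x * r = y * r := by
  obtain ⟨_, r, hr⟩ := exists_comp_eq_of_frac_eq_one (C := MonoidCat M) (x := .star) (y := .star)
    (f := x) (g := y) h
  exact ⟨r, hr⟩

end Frac

namespace FSHom

variable {S : Type u} {S' : Type v} {P : SkeinPresentation S} {P' : SkeinPresentation S'}

/-- Recolouring keeps the braid, so in the version `BV` the second hypothesis supplies what the
underlying forest does not see. -/
theorem ext_of_recolor (φ : Recoloring P P') {X : ThompsonType} {n m : ℕ} {f g : FSHom P X n m}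
    (h : toVHom X f = toVHom X g) (h' : recolor φ X f = recolor φ X g) : f = g := by
  cases X with
  | F => exact Subtype.ext h
  | T => exact Subtype.ext h
  | V => exact h
  | BV => exact Subtype.ext (Prod.ext h (congrArg (fun f => f.1.2) h'))

theorem erase_constColor {σ : Type u} {π : HPPresentation σ} (a : σ) (X : ThompsonType) {n m : ℕ}
    (f : FSHom mono X n m) : recolor π.eraseColors X (recolor (π.constColor a) X f) = f := by
  cases X with
  | F => exact Subtype.ext (VHom.erase_constColor a _)
  | T => exact Subtype.ext (VHom.erase_constColor a _)
  | V => exact VHom.erase_constColor a f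
  | BV => exact Subtype.ext (Prod.ext (VHom.erase_constColor a _) rfl)

end FSHom

/-! ### Fractions of diagrams -/

/-- The class of a pair of diagrams in the `V`-version of the forest-skein group. -/
noncomputable def fracV {S : Type u} {P : SkeinPresentation S} {m : ℕ} (f g : VHom P 1 m) : FSGroup P .V :=
  frac (C := FSCat P .V) (x := ⟨1⟩) (y := ⟨m⟩) f g

theorem fracV_comp {S : Type u} {P : SkeinPresentation S} {m k : ℕ} (f g : VHom P 1 m)
    (p : VHom P m k) : fracV (f.comp p) (g.comp p) = fracV f g :=
  frac_comp (C := FSCat P .V) (x := ⟨1⟩) (y := ⟨m⟩) (z := ⟨k⟩) f g p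

theorem fracV_inv {m : ℕ} (f g : VHom mono 1 m) : (fracV f g)⁻¹ = fracV g f := rfl

theorem exists_fracV {S : Type u} {P : SkeinPresentation S} (x : FSGroup P .V) :
    ∃ (m : ℕ) (f g : VHom P 1 m), x = fracV f g := by
  obtain ⟨⟨m⟩, f, g, rfl⟩ := x.exists_rep
  exact ⟨m, f, g, rfl⟩

theorem walk_actPermQ2_fracV {m : ℕ} (f g : VHom mono 1 m) (q : Q2) :
    f.walk (0, actPermQ2 (fracV f g) q) = g.walk (0, q) :=
  actPermQ2_frac (n := ⟨m⟩) f g q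

theorem actPermQ2_fracV_eq {m : ℕ} {f g : VHom mono 1 m} {q q' : Q2}
    (h : f.walk (0, q') = g.walk (0, q)) : actPermQ2 (fracV f g) q = q' := by
  have := f.walk.injective ((walk_actPermQ2_fracV f g q).trans h.symm)
  exact congrArg Prod.snd this

theorem exists_walk_eq {m : ℕ} (f g : VHom mono 1 m) (q : Q2) :
    ∃ q', g.walk (0, q') = f.walk (0, q) :=
  ⟨_, walk_actPermQ2_fracV g f q⟩

/-- The class of a pair of diagrams in the forest-skein group. -/
noncomputable def fracX {S : Type u} {P : SkeinPresentation S} (X : ThompsonType) {m : ℕ}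
    (f g : FSHom P X 1 m) : FSGroup P X := frac (C := FSCat P X) (x := ⟨1⟩) (y := ⟨m⟩) f g

theorem fracX_comp {S : Type u} {P : SkeinPresentation S} (X : ThompsonType) {m k : ℕ}
    (f g : FSHom P X 1 m) (p : FSHom P X m k) :
    fracX X (FSHom.comp X f p) (FSHom.comp X g p) = fracX X f g :=
  frac_comp (C := FSCat P X) (x := ⟨1⟩) (y := ⟨m⟩) (z := ⟨k⟩) f g p

theorem fracX_self {S : Type u} {P : SkeinPresentation S} (X : ThompsonType) {m : ℕ}
    (f : FSHom P X 1 m) : fracX X f f = 1 :=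
  frac_self (C := FSCat P X) (x := ⟨1⟩) (y := ⟨m⟩) f

/-! ### The isomorphism -/

namespace HPPresentation

variable {σ : Type u} (π : HPPresentation σ) (a : σ)

/-- The fraction of the colours of two trees seen from corresponding points. -/
noncomputable def colorRatio (x : FSGroup π.skein .V) (q : Q2) : Frac π.Mon :=
  Quot.lift (fun P : FracPair (C := FSCat π.skein .V) ⟨1⟩ =>
    Frac.mk (VHom.pathColor (n := 1) (m := P.tgt.n) a P.num (0, q))
      (VHom.pathColor (n := 1) (m := P.tgt.n) a P.den (0, actPermQ2
        (fracV (VHom.erase (n := 1) (m := P.tgt.n) P.den) (VHom.erase P.num)) q))) (by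
    rintro ⟨⟨m⟩, f, g⟩ _ ⟨⟨k⟩, r, rfl⟩
    change VHom π.skein 1 m at f g
    change VHom π.skein m k at r
    change _ = Frac.mk ((f.comp r).pathColor a _) ((g.comp r).pathColor a
      (0, actPermQ2 (fracV (g.comp r).erase (f.comp r).erase) q))
    -- The two points reach the same leaf at the same rescaled point, so `r` contributes the same
    -- right factor to numerator and denominator.
    rw [VHom.erase_comp, VHom.erase_comp, fracV_comp, VHom.pathColor_comp, VHom.pathColor_comp,
      walk_actPermQ2_fracV, Frac.mk_mul_right]) x

theorem colorRatio_fracV {m : ℕ} (f g : VHom π.skein 1 m) {q q' : Q2}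
    (h : g.erase.walk (0, q') = f.erase.walk (0, q)) :
    π.colorRatio a (fracV f g) q = Frac.mk (f.pathColor a (0, q)) (g.pathColor a (0, q')) := by
  rw [← actPermQ2_fracV_eq h]
  rfl

variable [IsOreMonoid π.Mon]

theorem fracLength_mk (x y : π.Mon) :
    π.fracLength (Frac.mk x y) = π.lengthHom x / π.lengthHom y := rfl

theorem fracLength_gen : π.fracLength (π.gen a) = Multiplicative.ofAdd 1 := by
  rw [gen, fracLength_mk, map_one, div_one, lengthHom_of]

/-- Where only `a` is read on both sides, the colour ratio and the slope correction cancel. This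
gives both finiteness of the support and triviality of the decoration on the lifts of Thompson
elements. -/
theorem mk_pow_mul_zpow (d e : ℕ) :
    Frac.mk (PresentedMonoid.of π.rel a ^ d) (PresentedMonoid.of π.rel a ^ e) *
      π.gen a ^ ((e : ℤ) - d) = 1 := by
  have hg : Frac.ofMonoid (PresentedMonoid.of π.rel a) = π.gen a := rfl
  rw [Frac.mk_eq, map_pow, map_pow, hg, zpow_sub, zpow_natCast, zpow_natCast]
  group

theorem twist_eq_one {a : σ} (h : π.gen a ∈ Subgroup.center (Frac π.Mon)) {X : ThompsonType}
    (v : Thompson X) (q : Q2) : (π.twist a X).τ v q = 1 := by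
  refine MulEquiv.ext fun k => Subtype.ext ?_
  change π.gen a ^ (-logSlope v (v⁻¹ • q)) * k.1 * (π.gen a ^ (-logSlope v (v⁻¹ • q)))⁻¹ = k.1
  rw [← Subgroup.mem_center_iff.1 (zpow_mem h _) k.1, mul_inv_cancel_right]

variable [Nonempty σ]

/-- The morphism from the forest-skein group to the Thompson group that forgets the colours. -/
noncomputable def shape (X : ThompsonType) : FSGroup π.skein X →* Thompson X :=
  fracMap (π.eraseColors.functor X) ⟨1⟩

/-- The morphism to the `V`-version of the forest-skein group. -/
noncomputable def toGroupV (X : ThompsonType) : FSGroup π.skein X →* FSGroup π.skein .V :=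
  fracMap (vFunctor π.skein X) ⟨1⟩

/-- The action on dyadic rationals and the slopes factor through `V`, so decorations may be computed
in the `V`-version for every `X`. -/
theorem toV_shape {X : ThompsonType} (x : FSGroup π.skein X) :
    Thompson.toV X (π.shape X x) = π.shape .V (π.toGroupV X x) := by
  rw [Thompson.toV_eq]
  obtain ⟨y, f, g, rfl⟩ := x.exists_rep
  change frac (C := FSCat mono .V) (x := ⟨1⟩) (y := ⟨y.n⟩)
      (FSHom.toVHom X (FSHom.recolor π.eraseColors X f))
      (FSHom.toVHom X (FSHom.recolor π.eraseColors X g)) = _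
  rw [FSHom.toVHom_recolor, FSHom.toVHom_recolor]
  rfl

theorem shape_fracV {m : ℕ} (f g : VHom π.skein 1 m) :
    π.shape .V (fracV f g) = fracV f.erase g.erase := rfl

/-! ### The decoration and its cocycle identity. -/

/-- The value at `q` of the component of an element of the forest-skein group in `⊕ K_M`. -/
noncomputable def decoration (x : FSGroup π.skein .V) (q : Q2) : Frac π.Mon :=
  π.colorRatio a x q * π.gen a ^ logSlopeV (π.shape .V x) (actPermQ2 (π.shape .V x)⁻¹ q)

theorem decoration_fracV {m : ℕ} (f g : VHom π.skein 1 m) {q q' : Q2}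
    (h : g.erase.walk (0, q') = f.erase.walk (0, q)) :
    π.decoration a (fracV f g) q = Frac.mk (f.pathColor a (0, q)) (g.pathColor a (0, q')) *
      π.gen a ^ ((g.erase.depth (0, q') : ℤ) - f.erase.depth (0, q)) := by
  rw [decoration, colorRatio_fracV π a f g h, shape_fracV, fracV_inv, actPermQ2_fracV_eq h]
  congr 2
  refine (logSlopeV_frac (n := ⟨m⟩) f.erase g.erase q').trans ?_
  rw [show actPermQ2 (frac (C := FSCat mono .V) (x := ⟨1⟩) (y := ⟨m⟩) f.erase g.erase) q' = q from
    actPermQ2_fracV_eq h.symm]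

/-- The colour ratio has length the difference of the depths in numerator and denominator, and the
exponent of `a` is the opposite difference. -/
theorem decoration_mem (x : FSGroup π.skein .V) (q : Q2) : π.decoration a x q ∈ π.K := by
  obtain ⟨m, f, g, rfl⟩ := exists_fracV x
  obtain ⟨q', h⟩ := exists_walk_eq f.erase g.erase q
  rw [MonoidHom.mem_ker, decoration_fracV π a f g h, map_mul, map_zpow, fracLength_mk,
    fracLength_gen, VHom.lengthHom_pathColor, VHom.lengthHom_pathColor, ← ofAdd_sub, ← ofAdd_zsmul,
    ← ofAdd_add, ← ofAdd_zero]
  congr 1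
  simp

theorem decoration_eq_one {m : ℕ} (f g : VHom π.skein 1 m) {q : Q2}
    (h : (f.erase.walk (0, q)).2 ≠ 0) : π.decoration a (fracV f g) q = 1 := by
  obtain ⟨q', h'⟩ := exists_walk_eq f.erase g.erase q
  rw [decoration_fracV π a f g h', VHom.pathColor_eq_pow a f _ h,
    VHom.pathColor_eq_pow a g _ (h' ▸ h), mk_pow_mul_zpow]

/-- The support lies among the left endpoints of the leaves of the numerator, as other points read
only powers of `a`. -/
theorem decoration_finite (x : FSGroup π.skein .V) :
    (Function.mulSupport (π.decoration a x)).Finite := by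
  obtain ⟨m, f, g, rfl⟩ := exists_fracV x
  refine (Set.finite_range fun j : Fin m => (f.erase.walk.symm (j, 0)).2).subset fun q hq => ?_
  have h : (f.erase.walk (0, q)).2 = 0 := by
    by_contra h
    exact hq (π.decoration_eq_one a f g h)
  refine ⟨(f.erase.walk (0, q)).1, ?_⟩
  have : ((f.erase.walk (0, q)).1, (0 : Q2)) = f.erase.walk (0, q) := Prod.ext rfl h.symm
  simp only [this, Equiv.symm_apply_apply]

/-- With a common middle term $g$, the product $[f,g][g,h]$ telescopes in $\mathrm{Frac}(M)$ once
the points corresponding to $q$ in $g$ and $h$ are followed. No twist appears at this level. -/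
theorem colorRatio_mul (x y : FSGroup π.skein .V) (q : Q2) :
    π.colorRatio a (x * y) q =
      π.colorRatio a x q * π.colorRatio a y (actPermQ2 (π.shape .V x)⁻¹ q) := by
  obtain ⟨⟨m⟩, f, g, h, rfl, rfl⟩ := exists_rep₂ x y
  rw [frac_mul_same]
  change VHom π.skein 1 m at f g h
  obtain ⟨q', hq'⟩ := exists_walk_eq f.erase g.erase q
  obtain ⟨q'', hq''⟩ := exists_walk_eq g.erase h.erase q'
  change π.colorRatio a (fracV f h) q = π.colorRatio a (fracV f g) q *
    π.colorRatio a (fracV g h) (actPermQ2 (fracV g.erase f.erase) q)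
  rw [actPermQ2_fracV_eq hq', colorRatio_fracV π a f g hq', colorRatio_fracV π a g h hq'',
    colorRatio_fracV π a f h (hq''.trans hq'), Frac.mk_mul_mk]

/-- By the chain rule the corrections of $x$ and $y$ multiply to $a^{s_x+s_y}$. Inserting
$a^{s_x}a^{-s_x}$ between the two colour ratios leaves the decoration of $y$ conjugated by
$a^{-s_x}$, which is the twist. -/
theorem decoration_mul (x y : FSGroup π.skein .V) (q : Q2) :
    π.decoration a (x * y) q = π.decoration a x q *
      (π.gen a ^ (-logSlopeV (π.shape .V x) (actPermQ2 (π.shape .V x)⁻¹ q)) *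
        π.decoration a y (actPermQ2 (π.shape .V x)⁻¹ q) *
        (π.gen a ^ (-logSlopeV (π.shape .V x) (actPermQ2 (π.shape .V x)⁻¹ q)))⁻¹) := by
  simp only [decoration]
  rw [colorRatio_mul, map_mul (π.shape .V), logSlopeV_mul, mul_inv_rev, map_mul actPermQ2,
    Equiv.Perm.mul_apply]
  have : actPermQ2 (π.shape .V y) (actPermQ2 (π.shape .V y)⁻¹ (actPermQ2 (π.shape .V x)⁻¹ q)) =
      actPermQ2 (π.shape .V x)⁻¹ q := by
    rw [← Equiv.Perm.mul_apply, ← map_mul, mul_inv_cancel, map_one, Equiv.Perm.one_apply]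
  rw [this, add_comm, zpow_add, zpow_neg]
  group

/-- The morphism from the forest-skein group to the twisted wreath product. -/
noncomputable def toWreath (X : ThompsonType) :
    FSGroup π.skein X →* TwistedWreath (π.twist a X) :=
  MonoidHom.mk' (fun x => ⟨⟨fun q => ⟨π.decoration a (π.toGroupV X x) q, π.decoration_mem a _ q⟩, by
      refine (π.decoration_finite a (π.toGroupV X x)).subset fun q hq h => hq (Subtype.ext h)⟩,
    π.shape X x⟩) (by
    intro x y
    refine SemidirectProduct.ext (Subtype.ext (funext fun q => Subtype.ext ?_))
      (map_mul (π.shape X) x y)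
    change π.decoration a (π.toGroupV X (x * y)) q = _
    rw [map_mul, decoration_mul, ← toV_shape, ← map_inv]
    rfl)

/-! ### Components and injectivity of the morphism to the wreath product. -/

theorem toWreath_left {X : ThompsonType} (x : FSGroup π.skein X) (q : Q2) :
    (((π.toWreath a X x).left.1 q : π.K) : Frac π.Mon) = π.decoration a (π.toGroupV X x) q := rfl

theorem toWreath_right {X : ThompsonType} (x : FSGroup π.skein X) :
    (π.toWreath a X x).right = π.shape X x := rfl

theorem toGroupV_fracX {X : ThompsonType} {m : ℕ} (f g : FSHom π.skein X 1 m) :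
    π.toGroupV X (fracX X f g) = fracV (FSHom.toVHom X f) (FSHom.toVHom X g) := rfl

theorem shape_fracX {X : ThompsonType} {m : ℕ} (f g : FSHom π.skein X 1 m) :
    π.shape X (fracX X f g) =
      fracX X (FSHom.recolor π.eraseColors X f) (FSHom.recolor π.eraseColors X g) := rfl

theorem toWreath_injective (X : ThompsonType) : Function.Injective (π.toWreath a X) := by
  rw [injective_iff_map_eq_one]
  intro x hx
  obtain ⟨⟨m⟩, f, g, rfl⟩ := x.exists_rep
  change FSHom π.skein X 1 m at f g
  change fracX X f g = 1
  change π.toWreath a X (fracX X f g) = 1 at hx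
  -- Triviality of the shape gives a monochromatic `p` that makes the two shapes equal, braids
  -- included. Coloured with `a`, it can be applied to `f` and `g` without changing the fraction.
  obtain ⟨⟨k⟩, p, hp⟩ := exists_comp_eq_of_frac_eq_one
    (C := FSCat mono X) (x := ⟨1⟩) (y := ⟨m⟩) (f := FSHom.recolor π.eraseColors X f)
    (g := FSHom.recolor π.eraseColors X g) (congrArg (fun y => y.right) hx)
  change FSHom mono X m k at p
  change FSHom.comp X _ p = FSHom.comp X _ p at hp
  rw [← fracX_comp X f g (FSHom.recolor (π.constColor a) X p)] at hx ⊢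
  have he : FSHom.recolor π.eraseColors X (FSHom.comp X f (FSHom.recolor (π.constColor a) X p)) =
      FSHom.recolor π.eraseColors X (FSHom.comp X g (FSHom.recolor (π.constColor a) X p)) := by
    rw [FSHom.recolor_comp, FSHom.recolor_comp, FSHom.erase_constColor, hp]
  generalize FSHom.comp X f (FSHom.recolor (π.constColor a) X p) = f at *
  generalize FSHom.comp X g (FSHom.recolor (π.constColor a) X p) = g at *
  have hV : (FSHom.toVHom X f).erase = (FSHom.toVHom X g).erase := by
    rw [VHom.erase, ← FSHom.toVHom_recolor, he, FSHom.toVHom_recolor, VHom.erase]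
  -- With equal shapes the slope correction vanishes and the decoration is the bare ratio of path
  -- colours. Its triviality means that some common right factor equalises them.
  have hr : ∀ j : Fin k, ∃ r : π.Mon,
      (FSHom.toVHom X f).pathColor a ((FSHom.toVHom X f).erase.walk.symm (j, 0)) * r =
      (FSHom.toVHom X g).pathColor a ((FSHom.toVHom X f).erase.walk.symm (j, 0)) * r := by
    intro j
    obtain ⟨i, q⟩ := (FSHom.toVHom X f).erase.walk.symm (j, 0)
    obtain rfl : i = 0 := Subsingleton.elim _ _
    apply Frac.exists_mul_eq_of_mk_eq_one
    have h : π.decoration a (π.toGroupV X (fracX X f g)) q = 1 := by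
      rw [← toWreath_left, hx]
      rfl
    rw [toGroupV_fracX, decoration_fracV π a _ _ (q' := q) (by rw [hV]), hV, sub_self, zpow_zero,
      mul_one] at h
    exact h
  choose r hr using hr
  -- The same multipliers on both sides give the same vine forest, so $[f,g]=[f\circ s,g\circ s]$
  -- with equal terms.
  obtain ⟨l, s, s', hs, hss⟩ := π.exists_comp_vines_eq a hV r r hr
  obtain rfl := hss rfl
  rw [← fracX_comp X f g (FSHom.ofF X s), FSHom.ext_of_recolor (X := X) π.eraseColors
    (f := FSHom.comp X f (FSHom.ofF X s)) (g := FSHom.comp X g (FSHom.ofF X s)), fracX_self]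
  · rw [FSHom.toVHom_comp, FSHom.toVHom_comp, FSHom.toVHom_ofF, hs]
  · rw [FSHom.recolor_comp, FSHom.recolor_comp, he]

end HPPresentation

/-! ### Surjectivity. -/

theorem walk_fullTree {β : Type} (N : ℕ) (e : (Fin N → Bool) → β) (q : Q2)
    (h : ∃ k : ℤ, q.1 * 2 ^ N = k) : ((fullTree N e).walk q).2 = 0 := by
  induction N generalizing q with
  | zero =>
    obtain ⟨k, hk⟩ := h
    rw [pow_zero, mul_one] at hk
    have h0 : (0 : ℚ) ≤ k := hk ▸ q.2.1
    have h1 : (k : ℚ) < 1 := hk ▸ q.2.2.1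
    have : k = 0 := by
      have h0' : (0 : ℤ) ≤ k := by exact_mod_cast h0
      have h1' : k < (1 : ℤ) := by exact_mod_cast h1
      omega
    exact Q2.val_eq_zero_iff.1 (by change q.1 = 0; rw [hk, this, Int.cast_zero])
  | succ N ih =>
    obtain ⟨k, hk⟩ := h
    rw [pow_succ] at hk
    simp only [fullTree, CTree.walk]
    split_ifs with h
    · refine ih _ _ ⟨k, ?_⟩
      simp only [Q2.double, if_pos h]
      linarith
    · refine ih _ _ ⟨k - 2 ^ N, ?_⟩
      simp only [Q2.double, if_neg h]
      push_cast
      linarith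

/-- Every finite set of dyadic rationals consists of left endpoints of the standard dyadic
intervals of some tree. -/
theorem exists_walk_eq_zero {s : Set Q2} (hs : s.Finite) :
    ∃ (m : ℕ) (t : FSHom mono .F 1 m), ∀ q ∈ s, (t.1.walk (0, q)).2 = 0 := by
  choose n k hk using fun q : Q2 => q.2.2.2
  -- A common bound for the denominators: every point of `s` is a multiple of $2^{-N}$, hence starts
  -- a leaf of the full tree of height `N`.
  let N := ∑ q ∈ hs.toFinset, n q
  obtain ⟨g, hg⟩ := VForest.exists_full (VForest.id 1) N (fun i => Nat.zero_le _)
    (Fintype.equivFin (Fin 1 × (Fin N → Bool)))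
  refine ⟨_, (VHom.mk g).straighten, fun q hq => ?_⟩
  rw [VHom.walk_straighten_snd]
  change ((g.tree 0).walk q).2 = 0
  rw [show g.tree 0 = _ from hg 0]
  apply walk_fullTree
  have hN : n q ≤ N := Finset.single_le_sum (f := n) (fun _ _ => Nat.zero_le _)
    (hs.mem_toFinset.2 hq)
  obtain ⟨d, hd⟩ := Nat.exists_eq_add_of_le hN
  refine ⟨k q * 2 ^ d, ?_⟩
  rw [hd, pow_add, ← mul_assoc, hk q]
  push_cast
  rfl

namespace HPPresentation

variable {σ : Type u} (π : HPPresentation σ) [IsOreMonoid π.Mon] (a : σ) [Nonempty σ]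

/-- Colouring every vertex of $v=[f,g]$ with `a` gives a preimage: its ratios are powers of `a`,
exactly cancelled by the slope correction. -/
theorem inr_mem_range_toWreath (X : ThompsonType) (v : Thompson X) :
    SemidirectProduct.inr v ∈ (π.toWreath a X).range := by
  obtain ⟨⟨m⟩, f, g, rfl⟩ := v.exists_rep
  change FSHom mono X 1 m at f g
  refine ⟨fracX X (FSHom.recolor (π.constColor a) X f) (FSHom.recolor (π.constColor a) X g),
    SemidirectProduct.ext (Subtype.ext (funext fun q => Subtype.ext ?_)) ?_⟩
  · rw [toWreath_left, toGroupV_fracX, FSHom.toVHom_recolor, FSHom.toVHom_recolor]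
    obtain ⟨q', h⟩ := exists_walk_eq (FSHom.toVHom X f) (FSHom.toVHom X g) q
    rw [decoration_fracV π a _ _ (q' := q') (by rwa [VHom.erase_constColor, VHom.erase_constColor]),
      VHom.pathColor_constColor, VHom.pathColor_constColor, VHom.erase_constColor,
      VHom.erase_constColor, mk_pow_mul_zpow]
    rfl
  · rw [toWreath_right, shape_fracX, FSHom.erase_constColor, FSHom.erase_constColor]
    rfl

/-- On a tree of colour `a` whose leaves start at the points of the support, two vine forests of the
same shape are grown. Equal shapes make the Thompson component trivial, and the words on the vines
encode the values of `k`. -/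
theorem inl_mem_range_toWreath (X : ThompsonType) (k : finSupp Q2 π.K) :
    SemidirectProduct.inl k ∈ (π.toWreath a X).range := by
  obtain ⟨m, t, ht⟩ := exists_walk_eq_zero k.2
  -- The path through `t` contributes $a^d$ to both terms, giving the decoration
  -- $a^d[x_j,y_j]a^{-d}$. The value of `k` is therefore conjugated beforehand.
  have hxy : ∀ j : Fin m, ∃ x y : π.Mon, Frac.mk x y =
      (π.gen a ^ t.1.depth (t.1.walk.symm (j, 0)))⁻¹ *
        (k.1 (t.1.walk.symm (j, 0)).2 : Frac π.Mon) * π.gen a ^ t.1.depth (t.1.walk.symm (j, 0)) :=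
    fun j => Frac.exists_mk _
  choose x y hxy using hxy
  -- Membership of the values in $K_M$ is what allows the two vines at a leaf to have the same
  -- length.
  have hlen : ∀ j, π.lengthHom (x j) = π.lengthHom (y j) := fun j => by
    have h := congrArg π.fracLength (hxy j)
    rw [fracLength_mk, map_mul, map_mul, map_inv, (k.1 _).2, mul_one, inv_mul_cancel] at h
    exact div_eq_one.1 h
  obtain ⟨l, p, p', he, h0, h1⟩ := π.exists_vines a x y hlen
  let T : FSHom π.skein .F 1 m := FSHom.recolor (π.constColor a) .F t
  have hT : T.1.erase = t.1 := VHom.erase_constColor a t.1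
  have he' : (T.1.comp p.1).erase = (T.1.comp p'.1).erase := by
    rw [VHom.erase_comp, VHom.erase_comp, he]
  refine ⟨fracX X (FSHom.ofF X (FSHom.comp .F T p)) (FSHom.ofF X (FSHom.comp .F T p')),
    SemidirectProduct.ext (Subtype.ext (funext fun q => Subtype.ext ?_)) ?_⟩
  · rw [toWreath_left, toGroupV_fracX, FSHom.toVHom_ofF, FSHom.toVHom_ofF]
    change π.decoration a (fracV (T.1.comp p.1) (T.1.comp p'.1)) q = (k.1 q : Frac π.Mon)
    rw [decoration_fracV π a _ _ (q' := q) (by rw [he']), he', sub_self, zpow_zero, mul_one,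
      VHom.pathColor_comp, VHom.pathColor_comp, hT]
    -- Away from the left endpoints of the leaves of `t`, the two vine forests read the same and `k`
    -- is trivial, because `t` was chosen to cover the support.
    by_cases hq : (t.1.walk (0, q)).2 = 0
    · have hj : t.1.walk (0, q) = ((t.1.walk (0, q)).1, 0) := Prod.ext rfl hq
      have hs : t.1.walk.symm ((t.1.walk (0, q)).1, 0) = (0, q) := by
        rw [← hj, Equiv.symm_apply_apply]
      have hk := hxy (t.1.walk (0, q)).1
      rw [hs, Frac.mk_eq] at hk
      have hg : Frac.ofMonoid (PresentedMonoid.of π.rel a) = π.gen a := rfl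
      have hc : T.1.pathColor a (0, q) = PresentedMonoid.of π.rel a ^ t.1.depth (0, q) :=
        VHom.pathColor_constColor a t.1 _
      rw [hj, (h0 _).1, (h0 _).2, hc, Frac.mk_eq, map_mul, map_mul, map_pow, hg, mul_inv_rev,
        mul_assoc, ← mul_assoc (Frac.ofMonoid _) (Frac.ofMonoid _)⁻¹, hk]
      group
    · rw [h1 _ hq, Frac.mk_eq, mul_inv_cancel]
      have : k.1 q = 1 := by
        by_contra h
        exact hq (ht q h)
      rw [this]
      rfl
  · rw [toWreath_right, shape_fracX, FSHom.recolor_ofF, FSHom.recolor_ofF]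
    rw [show FSHom.recolor π.eraseColors .F (FSHom.comp .F T p) =
      FSHom.recolor π.eraseColors .F (FSHom.comp .F T p') from Subtype.ext he', fracX_self]
    rfl

theorem toWreath_surjective (X : ThompsonType) : Function.Surjective (π.toWreath a X) := by
  intro z
  rw [← SemidirectProduct.inl_left_mul_inr_right z]
  exact mul_mem (π.inl_mem_range_toWreath a X z.left) (π.inr_mem_range_toWreath a X z.right)

end HPPresentation

end ForestSkein

open ForestSkein in
theorem theoremA {σ : Type u} (π : HPPresentation σ) [IsOreMonoid π.Mon] (a : σ) (X : ThompsonType) :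
    (∃ _ : IsOreCategory (FSCat π.skein X),
      Nonempty (FSGroup π.skein X ≃* TwistedWreath (π.twist a X))) ∧
    (π.gen a ∈ Subgroup.center (Frac π.Mon) →
      ∀ (v : Thompson X) (q : Q2), (π.twist a X).τ v q = 1) := by
  have : Nonempty σ := ⟨a⟩
  exact ⟨⟨inferInstance, ⟨MulEquiv.ofBijective (π.toWreath a X)
    ⟨π.toWreath_injective a X, π.toWreath_surjective a X⟩⟩⟩, fun h v q => π.twist_eq_one h v q⟩
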